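/- Let $S$ be a nonempty closed topological surface with a finite cellular decomposition $\Sigma=(V,E,F)$ in which every 2-cell has a 1-cell on its boundary, and let $\Phi:E\to(0,\frac{\pi}{2})$ be a weight. Choose an auxiliary point in every 2-cell and join it to the vertices on the boundary of that 2-cell; this cuts $S$ into quadrilaterals $Q(e)$, $e\in E$, whose vertices are the end points of $e$ and the auxiliary points of the 2-cells on the two sides of $e$. For radii $\mathbf r=(r_f)_{f\in F}\in(0,\frac{\pi}{2}]^{F}$, identify every $Q(e)$ with the spherical quadrilateral spanned by the centres and the two boundary intersection points of two disks in the unit sphere $\mathbb S^2$ that have the radii of the 2-cells on the two sides of $e$ and whose intersection is a bigon with interior angle $\Phi(e)$; gluing these quadrilaterals isometrically along their sides gives a spherical conical metric on $S$ with a circle pattern (one immersed disk of radius $r_f$ for each 2-cell $f$). It is called a degenerated circle pattern metric if $r_f=\frac{\pi}{2}$ for at least one $f\in F$, i.e. if some geodesic curvature $k_f=\cot r_f$ is $0$. Its total geodesic curvature is the vector $L=(L_f)_{f\in F}$ with $L_f=\sum_e \ell_{f,e}k_f$, the sum being over the sides of 1-cells that lie on $\partial f$ (a 1-cell with $f$ on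 both sides is counted twice), where $\ell_{f,e}$ is the length of the corresponding side, on the boundary circle of the disk of $f$, of the bigon belonging to $e$. For $F'\subset F$ let $E_{F'}$ be the set of 1-cells that lie on the boundary of some $f\in F'$. For a nonempty proper subset $I\subsetneq F$ put $$\mathcal L_I=\Big\{L\in\mathbb R^{F}\ \Big|\ L_f=0\ (f\notin I),\ L_f>0\ (f\in I),\ \sum_{f\in F'}L_f<2\sum_{e\in E_{F'}}\Phi(e)\ \text{ for all } \emptyset\ne F'\subset I\Big\},$$ and let $$\bar\partial\mathcal L=\{0\}\cup\bigcup_{\emptyset\ne I\subsetneq F}\mathcal L_I .$$ Then for every $\hat L\in\mathbb R^{F}$ there exists a degenerated circle pattern metric on $S$ with total geodesic curvature $\hat L$ if and only if $\hat L\in\bar\partial\mathcal L$. Moreover, this metric is unique up to isometry if it exists: any two such metrics have the same radii, and there is an isometry between them that carries one circle pattern to the other, maps every $Q(e)$ to itself and fixes the vertices and the auxiliary points. -/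

import Mathlib

open scoped ENNReal

noncomputable section

namespace SphericalPattern

/-! ### Cellular decompositions of closed surfaces -/

/-- The model quadrilateral `|x| + |y| ≤ 1`.  Its corners `(-1, 0)`, `(1, 0)` stand for the auxiliary
points of the two 2-cells beside a 1-cell, its corners `(0, -1)`, `(0, 1)` for the two end points of
the 1-cell, and the vertical diagonal for the 1-cell itself. -/
abbrev Square : Type := {x : ℝ × ℝ // |x.1| + |x.2| ≤ 1}

/-- `false ↦ -1`, `true ↦ 1`. -/
def sgn (b : Bool) : ℝ := cond b 1 (-1)

theorem abs_sgn (b : Bool) : |sgn b| = 1 := by cases b <;> simp [sgn]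

/-- The side of the model quadrilateral from the auxiliary point on side `s` (parameter `0`) to the
end point `t` (parameter `1`). -/
def leg (s t : Bool) (c : unitInterval) : Square :=
  ⟨((1 - (c : ℝ)) * sgn s, (c : ℝ) * sgn t), by
    have h0 := c.2.1
    have h1 := c.2.2
    simp only [abs_mul, abs_sgn, mul_one]
    rw [abs_of_nonneg (sub_nonneg.2 h1), abs_of_nonneg h0]
    linarith⟩

/-- The identifications of the quadrilaterals `Q(e)`, `e : E`, along their sides that are prescribed by
a map `next` on the set `E × Bool × Bool` of all these sides; `(e, s, t)` is the side of `Q(e)` from the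
auxiliary point on side `s` of `e` to the end point `t` of `e`. -/
def Glue {E : Type*} (next : E × Bool × Bool → E × Bool × Bool) (x y : E × Square) : Prop :=
  ∃ (a : E × Bool × Bool) (c : unitInterval),
    x = (a.1, leg a.2.1 a.2.2 c) ∧ y = ((next a).1, leg (next a).2.1 (next a).2.2 c)

/-- A (finite) cellular decomposition of the surface `S` with set of 1-cells `E` and set of 2-cells
`F`, together with auxiliary points in the 2-cells, joined to the vertices on their boundaries.
Every 1-cell `e` has two sides and two ends, both labelled by `Bool`; the 2-cell on side `s` of `e` is
`face e s` (both sides may belong to the same 2-cell).  The quadrilateral `Q(e)` is the image of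
`chart e`, and `S` is obtained from the quadrilaterals by identifying their sides in pairs. -/
structure CellDecomposition (S : Type*) [TopologicalSpace S] (E F : Type*) where
  /-- the 2-cell on the given side of a 1-cell -/
  face : E → Bool → F
  /-- the segment from an auxiliary point to a vertex, seen as a side of `Q(e)`, is also a side of the
  quadrilateral of the neighbouring 1-cell on the boundary of the same 2-cell -/
  next : E × Bool × Bool → E × Bool × Bool
  next_next : ∀ a, next (next a) = a
  next_ne : ∀ a, next a ≠ a
  face_surjective : ∀ f, ∃ e s, face e s = f
  /-- the sides of 1-cells on the boundary of one 2-cell are those met when going round it -/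
  face_eq_iff : ∀ e s e' s', face e s = face e' s' ↔
    Relation.EqvGen (fun x y : E × Bool => ∃ t t', next (x.1, x.2, t) = (y.1, y.2, t'))
      (e, s) (e', s')
  chart : E → Square → S
  continuous_chart : ∀ e, Continuous (chart e)
  chart_surjective : ∀ p, ∃ e x, chart e x = p
  chart_eq_iff : ∀ e x e' x', chart e x = chart e' x' ↔
    Relation.EqvGen (Glue next) (e, x) (e', x')

/-! ### Spherical bigons and quadrilaterals -/

/-- Spherical distance of the centres of two spherical disks of radii `r₁`, `r₂` which meet at the
angle `φ` (the interior angle of their intersection). -/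
def centerDist (φ r₁ r₂ : ℝ) : ℝ :=
  Real.arccos (Real.cos r₁ * Real.cos r₂ - Real.sin r₁ * Real.sin r₂ * Real.cos φ)

/-- Angle at the centre of the first disk between the centre of the second disk and an
intersection point of the two boundary circles (spherical law of cosines). -/
def halfAngle (φ r₁ r₂ : ℝ) : ℝ :=
  Real.arccos ((Real.cos r₂ - Real.cos r₁ * Real.cos (centerDist φ r₁ r₂)) /
    (Real.sin r₁ * Real.sin (centerDist φ r₁ r₂)))

/-- Length of the side of the bigon that lies on the boundary of the first disk: an arc with central
angle `2 * halfAngle` of a circle of spherical radius `r₁`. -/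
def sideLength (φ r₁ r₂ : ℝ) : ℝ := 2 * halfAngle φ r₁ r₂ * Real.sin r₁

/-- Total geodesic curvature of that side; the boundary circle has geodesic curvature `cot r₁`. -/
def sideCurvature (φ r₁ r₂ : ℝ) : ℝ := sideLength φ r₁ r₂ * Real.cot r₁

/-- Ambient space of the unit sphere. The spherical distance of unit vectors is their angle. -/
abbrev E3 : Type := EuclideanSpace ℝ (Fin 3)

/-- Centres of the first (`false`) and the second (`true`) disk, placed on the unit sphere. -/
def center (φ r₁ r₂ : ℝ) (s : Bool) : E3 :=
  cond s !₂[Real.cos (centerDist φ r₁ r₂), Real.sin (centerDist φ r₁ r₂), 0] !₂[1, 0, 0]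

/-- The two intersection points of the boundary circles of these disks. -/
def corner (φ r₁ r₂ : ℝ) (t : Bool) : E3 :=
  !₂[Real.cos r₁, Real.sin r₁ * Real.cos (halfAngle φ r₁ r₂),
    sgn t * (Real.sin r₁ * Real.sin (halfAngle φ r₁ r₂))]

/-- The (convex) spherical quadrilateral spanned by the two centres and the two intersection points. -/
def quad (φ r₁ r₂ : ℝ) : Set E3 :=
  {x | ‖x‖ = 1 ∧ ∃ a b c d : ℝ, 0 ≤ a ∧ 0 ≤ b ∧ 0 ≤ c ∧ 0 ≤ d ∧
    x = a • center φ r₁ r₂ false + b • center φ r₁ r₂ true +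
      c • corner φ r₁ r₂ false + d • corner φ r₁ r₂ true}

/-! ### Spherical conical metrics with circle patterns -/

/-- A spherical conical metric with circle pattern on `S` which realizes the weight `Φ`: radii in
`(0, π/2]` of the disks, and an identification of every `Q(e)` with the spherical quadrilateral of
two disks which have the radii of the 2-cells beside `e` and intersection angle `Φ e`, such that
these identifications agree isometrically on the common sides of the quadrilaterals. -/
structure ConicalMetric {S : Type*} [TopologicalSpace S] {E F : Type*}
    (D : CellDecomposition S E F) (Φ : E → ℝ) where
  radius : F → ℝ
  radius_pos : ∀ f, 0 < radius f
  radius_le : ∀ f, radius f ≤ Real.pi / 2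
  coord : ∀ e, Square ≃ₜ quad (Φ e) (radius (D.face e false)) (radius (D.face e true))
  coord_center : ∀ e s t, (coord e (leg s t 0) : E3) =
    center (Φ e) (radius (D.face e false)) (radius (D.face e true)) s
  coord_corner : ∀ e s t, (coord e (leg s t 1) : E3) =
    corner (Φ e) (radius (D.face e false)) (radius (D.face e true)) t
  /-- sides are mapped to geodesic segments -/
  coord_leg : ∀ e s t c,
    InnerProductGeometry.angle (coord e (leg s t 0) : E3) (coord e (leg s t c)) +
      InnerProductGeometry.angle (coord e (leg s t c) : E3) (coord e (leg s t 1)) =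
    InnerProductGeometry.angle (coord e (leg s t 0) : E3) (coord e (leg s t 1))
  /-- identified sides are identified isometrically -/
  coord_glue : ∀ e s t e' s' t' c, D.next (e, s, t) = (e', s', t') →
    InnerProductGeometry.angle (coord e (leg s t 0) : E3) (coord e (leg s t c)) =
    InnerProductGeometry.angle (coord e' (leg s' t' 0) : E3) (coord e' (leg s' t' c))

namespace ConicalMetric

variable {S : Type*} [TopologicalSpace S] {E F : Type*} {D : CellDecomposition S E F} {Φ : E → ℝ}

/-- Distance of two points inside a common spherical quadrilateral (`⊤` if there is none). -/
def localDist (M : ConicalMetric D Φ) (p q : S) : ℝ≥0∞ :=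
  ⨅ (e : E) (x : Square) (y : Square) (_ : D.chart e x = p ∧ D.chart e y = q),
    ENNReal.ofReal (InnerProductGeometry.angle (M.coord e x : E3) (M.coord e y))

/-- The distance function on `S` obtained by gluing the spherical quadrilaterals: infimum of the
lengths of chains of points (`⊤` for points in different components). -/
def dist (M : ConicalMetric D Φ) (p q : S) : ℝ≥0∞ :=
  ⨅ (n : ℕ) (z : Fin (n + 1) → S) (_ : z 0 = p ∧ z (Fin.last n) = q),
    ∑ i : Fin n, M.localDist (z i.castSucc) (z i.succ)

/-- The immersed disk of the circle pattern that belongs to the 2-cell `f` (its image in `S`). -/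
def disk (M : ConicalMetric D Φ) (f : F) : Set S :=
  {p | ∃ e s x, D.face e s = f ∧ D.chart e x = p ∧
    InnerProductGeometry.angle
      (center (Φ e) (M.radius (D.face e false)) (M.radius (D.face e true)) s)
      (M.coord e x : E3) < M.radius f}

/-- A degenerated circle pattern metric: some radius is `π/2`. -/
def IsDegenerated (M : ConicalMetric D Φ) : Prop := ∃ f, M.radius f = Real.pi / 2

open Classical in
/-- Total geodesic curvature of the 2-cell `f`: the sum over all sides of 1-cells on the boundary of
`f` (a 1-cell with `f` on both sides contributes both sides of its bigon). -/
def totalCurvature [Fintype E] (M : ConicalMetric D Φ) (f : F) : ℝ :=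
  ∑ e : E, ∑ s : Bool, if D.face e s = f then
    sideCurvature (Φ e) (M.radius (D.face e s)) (M.radius (D.face e (!s))) else 0

/-- The metrics agree up to isometry: corresponding disks have equal radii, and there is an isometry
of `S` which carries one circle pattern to the other, and which respects the decomposition (it maps
each quadrilateral to itself and fixes the vertices and the auxiliary points). -/
def IsIsometric (M M' : ConicalMetric D Φ) : Prop :=
  M.radius = M'.radius ∧
  ∃ ψ : S ≃ₜ S,
    (∀ p q, M'.dist (ψ p) (ψ q) = M.dist p q) ∧
    (∀ f, ψ '' M.disk f = M'.disk f) ∧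
    (∀ e, ψ '' Set.range (D.chart e) = Set.range (D.chart e)) ∧
    (∀ e s t, ψ (D.chart e (leg s t 0)) = D.chart e (leg s t 0)) ∧
    (∀ e s t, ψ (D.chart e (leg s t 1)) = D.chart e (leg s t 1))

end ConicalMetric

/-! ### Admissible total geodesic curvatures -/

open Classical in
/-- The set `E_{F'}` of the 1-cells on the boundary of some 2-cell in `F'`. -/
def edgesOf {S : Type*} [TopologicalSpace S] {E F : Type*} [Fintype E]
    (D : CellDecomposition S E F) (F' : Finset F) : Finset E :=
  Finset.univ.filter fun e => ∃ s, D.face e s ∈ F'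

/-- The set `𝓛_I`: vectors supported exactly on `I`, positive there, with the strict inequalities for
all nonempty subsets of `I`. -/
def curvatureSet {S : Type*} [TopologicalSpace S] {E F : Type*} [Fintype E]
    (D : CellDecomposition S E F) (Φ : E → ℝ) (I : Finset F) : Set (F → ℝ) :=
  {L | (∀ f, f ∉ I → L f = 0) ∧ (∀ f ∈ I, 0 < L f) ∧
    ∀ F' : Finset F, F' ⊆ I → F'.Nonempty →
      ∑ f ∈ F', L f < 2 * ∑ e ∈ edgesOf D F', Φ e}

/-- The union of `{0}` and the sets `𝓛_I` for the nonempty proper subsets `I` of the set of 2-cells. -/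
def degeneratedCurvatureSet {S : Type*} [TopologicalSpace S] {E F : Type*} [Fintype E] [Fintype F]
    (D : CellDecomposition S E F) (Φ : E → ℝ) : Set (F → ℝ) :=
  (⋃ (I : Finset F) (_ : I.Nonempty ∧ I ≠ Finset.univ), curvatureSet D Φ I) ∪ {0}

end SphericalPattern

end

/-!
In terms of the geodesic curvatures `k = cot r`, the total curvature of one side of a bigon of angle
`φ` decreases with the curvature of the other side, whereas the total over both sides strictly
increases with either curvature and tends to its supremum `2 φ` as one of them tends to `∞`. The map
`T` from geodesic to total curvatures is therefore antitone off the diagonal, and the sum of its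
components is strictly increasing. If `T k = T k'`, then `T (k ⊔ k') ≤ T k`, so that strict
monotonicity of the sum forces `k = k ⊔ k' = k'`. For `L` satisfying the inequalities, the vectors
`k ≥ 0` with `T k ≤ L` form a compact set, since sums of total curvatures come close to their bound
`2 ∑ Φ` near infinity, and a largest one solves `T k = L`. A total curvature vanishes exactly when
the geodesic curvature does, which singles out the degenerated metrics.

Every choice of radii is realized by a metric: the central projection maps a flat kite
homeomorphically to the spherical one. Two metrics with equal radii identify each `Q(e)` with the
same spherical kite. The induced self-maps of the `Q(e)` agree along the glued sides, because a
point of a side is determined by its distance from the auxiliary point.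
-/

noncomputable section

namespace SphericalPattern

open Real Filter Topology Set InnerProductGeometry

/-! ### Bigons as functions of geodesic curvatures -/

section Arccot

/-- The inverse of the cotangent on `(0, π)`. -/
def arccot (x : ℝ) : ℝ := π / 2 - arctan x

theorem arccot_pos (x : ℝ) : 0 < arccot x := sub_pos.2 (arctan_lt_pi_div_two x)

theorem arccot_cot {x : ℝ} (hx₀ : 0 < x) (hx : x < π) : arccot (cot x) = x := by
  rw [arccot, ← tan_inv_eq_cot, ← tan_pi_div_two_sub, arctan_tan (by linarith) (by linarith),
    sub_sub_cancel]

theorem cot_arccot (x : ℝ) : cot (arccot x) = x := by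
  rw [arccot, ← tan_inv_eq_cot, ← tan_pi_div_two_sub, sub_sub_cancel, tan_arctan]

theorem continuous_arccot : Continuous arccot := continuous_const.sub continuous_arctan

theorem antitone_arccot : Antitone arccot := fun _ _ h => sub_le_sub_left (arctan_mono h) _

theorem tendsto_arccot_atTop : Tendsto arccot atTop (𝓝 0) := by
  have h := (tendsto_arctan_atTop.mono_right nhdsWithin_le_nhds).const_sub (π / 2)
  rwa [sub_self] at h

theorem sin_arccot (x : ℝ) : sin (arccot x) = cos (arctan x) := sin_pi_div_two_sub _

theorem cos_arccot (x : ℝ) : cos (arccot x) = sin (arctan x) := cos_pi_div_two_sub _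

theorem sin_arccot_sq (x : ℝ) : sin (arccot x) ^ 2 = 1 / (1 + x ^ 2) := by
  rw [sin_arccot, cos_sq_arctan]

theorem sin_arccot_mul_cos_arccot (x : ℝ) :
    sin (arccot x) * cos (arccot x) = x * sin (arccot x) ^ 2 := by
  rw [sin_arccot, cos_arccot, ← tan_mul_cos (cos_arctan_pos x).ne', tan_arctan]
  ring

theorem hasDerivAt_arccot (x : ℝ) : HasDerivAt arccot (-sin (arccot x) ^ 2) x := by
  rw [sin_arccot_sq]
  exact (hasDerivAt_arctan x).const_sub (π / 2)

theorem sin_arctan_cot {x : ℝ} (hx₀ : 0 < x) (hx : x < π) : sin (arctan (cot x)) = cos x := by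
  rw [← cos_arccot, arccot_cot hx₀ hx]

theorem cos_arctan_cot {x : ℝ} (hx₀ : 0 < x) (hx : x < π) : cos (arctan (cot x)) = sin x := by
  rw [← sin_arccot, arccot_cot hx₀ hx]

theorem sin_arctan_eq_mul_cos (a : ℝ) : sin (arctan a) = a * cos (arctan a) := by
  rw [← tan_mul_cos (cos_arctan_pos a).ne', tan_arctan]

theorem hasDerivAt_sin_arctan (a : ℝ) :
    HasDerivAt (fun x => sin (arctan x)) (cos (arctan a) ^ 3) a := by
  refine (hasDerivAt_arctan a).sin.congr_deriv ?_
  rw [← cos_sq_arctan]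
  ring

theorem hasDerivAt_cos_arctan (a : ℝ) :
    HasDerivAt (fun x => cos (arctan x)) (-(sin (arctan a) * cos (arctan a) ^ 2)) a := by
  refine (hasDerivAt_arctan a).cos.congr_deriv ?_
  rw [← cos_sq_arctan]
  ring

theorem tendsto_sin_arctan_atTop : Tendsto (fun a => sin (arctan a)) atTop (𝓝 1) := by
  rw [← sin_pi_div_two]
  exact (continuous_sin.tendsto _).comp (tendsto_arctan_atTop.mono_right nhdsWithin_le_nhds)

theorem tendsto_cos_arctan_atTop : Tendsto (fun a => cos (arctan a)) atTop (𝓝 0) := by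
  rw [← cos_pi_div_two]
  exact (continuous_cos.tendsto _).comp (tendsto_arctan_atTop.mono_right nhdsWithin_le_nhds)

end Arccot

section Bigon

/-- Cotangent of the half central angle of the bigon side on the circle of geodesic curvature `a`,
for a bigon of angle `φ` whose other side has geodesic curvature `b`. The circle of geodesic
curvature `a = cot r` has `sin r = cos (arctan a)` and `cos r = sin (arctan a)`. -/
def cotSideAngle (φ a b : ℝ) : ℝ := (b * cos (arctan a) + sin (arctan a) * cos φ) / sin φ

/-- Half central angle of the bigon side on the circle of geodesic curvature `a`. -/
def sideAngle (φ a b : ℝ) : ℝ := arccot (cotSideAngle φ a b)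

/-- Total geodesic curvature of the bigon side of geodesic curvature `a`, where `b` is the geodesic
curvature of the other side. -/
def sideTotal (φ a b : ℝ) : ℝ := 2 * sideAngle φ a b * sin (arctan a)

/-- Total geodesic curvature of the whole boundary of the bigon. -/
def bigonTotal (φ a b : ℝ) : ℝ := sideTotal φ a b + sideTotal φ b a

variable {φ : ℝ}

theorem bigonTotal_comm (φ a b : ℝ) : bigonTotal φ a b = bigonTotal φ b a := add_comm _ _

theorem sideAngle_pos (φ a b : ℝ) : 0 < sideAngle φ a b := arccot_pos _

theorem sideTotal_zero (φ b : ℝ) : sideTotal φ 0 b = 0 := by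
  rw [sideTotal, arctan_zero, sin_zero, mul_zero]

theorem sideTotal_pos (φ : ℝ) {a : ℝ} (ha : 0 < a) (b : ℝ) : 0 < sideTotal φ a b := by
  have := sideAngle_pos φ a b
  have := sin_pos_of_pos_of_lt_pi (arctan_pos.2 ha) (by linarith [arctan_lt_pi_div_two a, pi_pos])
  unfold sideTotal
  positivity

theorem sideTotal_nonneg (φ : ℝ) {a : ℝ} (ha : 0 ≤ a) (b : ℝ) : 0 ≤ sideTotal φ a b := by
  obtain rfl | ha := ha.eq_or_lt
  · exact (sideTotal_zero φ b).ge
  · exact (sideTotal_pos φ ha b).le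

theorem continuous_sideTotal (φ : ℝ) : Continuous fun p : ℝ × ℝ => sideTotal φ p.1 p.2 := by
  unfold sideTotal sideAngle cotSideAngle
  have := continuous_arccot
  fun_prop

theorem tendsto_sideTotal_left (hφ : φ ∈ Ioo 0 π) (b : ℝ) :
    Tendsto (fun a => sideTotal φ a b) atTop (𝓝 (2 * φ)) := by
  have hcot : Tendsto (fun a => cotSideAngle φ a b) atTop (𝓝 (cot φ)) := by
    have h := ((tendsto_cos_arctan_atTop.const_mul b).add
      (tendsto_sin_arctan_atTop.mul_const (cos φ))).div_const (sin φ)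
    rwa [mul_zero, zero_add, one_mul, ← cot_eq_cos_div_sin] at h
  have h := (((continuous_arccot.tendsto _).comp hcot).const_mul 2).mul tendsto_sin_arctan_atTop
  rwa [arccot_cot hφ.1 hφ.2, mul_one] at h

section

variable (hφ : 0 < sin φ)
include hφ

theorem tendsto_sideTotal_right (a : ℝ) :
    Tendsto (fun b => sideTotal φ a b) atTop (𝓝 0) := by
  have hcot : Tendsto (fun b => cotSideAngle φ a b) atTop atTop :=
    (tendsto_atTop_add_const_right _ _
      (tendsto_id.atTop_mul_const (cos_arctan_pos a))).atTop_div_const hφ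
  have h := ((tendsto_arccot_atTop.comp hcot).const_mul 2).mul_const (sin (arctan a))
  rwa [mul_zero, zero_mul] at h

theorem sideTotal_antitone_right {a : ℝ} (ha : 0 ≤ a) : Antitone (sideTotal φ a) := by
  intro b b' hb
  have := cos_arctan_pos a
  have : 0 ≤ sin (arctan a) :=
    sin_nonneg_of_nonneg_of_le_pi (arctan_nonneg.2 ha)
      (by linarith [arctan_lt_pi_div_two a, pi_pos])
  have hangle : sideAngle φ a b' ≤ sideAngle φ a b :=
    antitone_arccot (by unfold cotSideAngle; gcongr)
  unfold sideTotal
  gcongr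

theorem sq_sin_sideAngle_mul_sq_cos_arctan (a b : ℝ) :
    sin (sideAngle φ a b) ^ 2 * cos (arctan a) ^ 2 =
      sin φ ^ 2 / (sin φ ^ 2 + a ^ 2 + b ^ 2 + 2 * a * b * cos φ) := by
  have := cos_arctan_pos a
  have hdisc : 0 < sin φ ^ 2 + a ^ 2 + b ^ 2 + 2 * a * b * cos φ := by
    nlinarith [sq_nonneg (a * cos φ + b), sin_sq_add_cos_sq φ,
      mul_nonneg (sq_nonneg a) (sq_nonneg (sin φ)), sq_pos_of_pos hφ]
  have hden : 0 < sin φ ^ 2 + (b * cos (arctan a) + sin (arctan a) * cos φ) ^ 2 := by positivity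
  have hcot : 1 + cotSideAngle φ a b ^ 2 =
      (sin φ ^ 2 + (b * cos (arctan a) + sin (arctan a) * cos φ) ^ 2) / sin φ ^ 2 := by
    unfold cotSideAngle
    field_simp
  rw [sideAngle, sin_arccot_sq, hcot, one_div_div, div_mul_eq_mul_div,
    div_eq_div_iff hden.ne' hdisc.ne']
  have hsin := sin_arctan_eq_mul_cos a
  have hone := sin_sq_add_cos_sq (arctan a)
  rw [hsin] at hone ⊢
  linear_combination sin φ ^ 4 * hone - sin φ ^ 2 * a ^ 2 * cos (arctan a) ^ 2 *
    sin_sq_add_cos_sq φ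

theorem sq_sin_sideAngle_comm (a b : ℝ) :
    sin (sideAngle φ a b) ^ 2 * cos (arctan a) ^ 2 =
      sin (sideAngle φ b a) ^ 2 * cos (arctan b) ^ 2 := by
  rw [sq_sin_sideAngle_mul_sq_cos_arctan hφ, sq_sin_sideAngle_mul_sq_cos_arctan hφ]
  ring

theorem hasDerivAt_bigonTotal_left (a b : ℝ) :
    HasDerivAt (fun x => bigonTotal φ x b)
      (2 * (sideAngle φ a b - sin (sideAngle φ a b) * cos (sideAngle φ a b)) *
        cos (arctan a) ^ 3) a := by
  have hcotLeft : HasDerivAt (fun x => cotSideAngle φ x b)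
      ((b * -(sin (arctan a) * cos (arctan a) ^ 2) + cos (arctan a) ^ 3 * cos φ) / sin φ) a :=
    (((hasDerivAt_cos_arctan a).const_mul b).add
      ((hasDerivAt_sin_arctan a).mul_const (cos φ))).div_const (sin φ)
  have hcotRight : HasDerivAt (fun x => cotSideAngle φ b x) (1 * cos (arctan b) / sin φ) a :=
    (((hasDerivAt_id a).mul_const (cos (arctan b))).add_const _).div_const (sin φ)
  have hleft := (((hasDerivAt_arccot _).comp a hcotLeft).const_mul 2).mul
    (hasDerivAt_sin_arctan a)
  have hright := (((hasDerivAt_arccot _).comp a hcotRight).const_mul 2).mul_const (sin (arctan b))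
  refine (hleft.add hright).congr_deriv ?_
  -- By this symmetry, the variation of the side with curvature `b` cancels the part of the first
  -- summand that stems from the explicit `b` in `cotSideAngle φ a b`.
  have hsines := sq_sin_sideAngle_comm hφ a b
  have hsc : sin (sideAngle φ a b) * cos (sideAngle φ a b) =
      cotSideAngle φ a b * sin (sideAngle φ a b) ^ 2 := sin_arccot_mul_cos_arccot _
  have hb := sin_arctan_eq_mul_cos b
  have hone := sin_sq_add_cos_sq (arctan a)
  rw [hsc, cotSideAngle]
  change (2 * (-sin (sideAngle φ a b) ^ 2 * _) * sin (arctan a) + 2 * sideAngle φ a b * _) +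
    2 * (-sin (sideAngle φ b a) ^ 2 * _) * sin (arctan b) = _
  rw [hb]
  field_simp
  linear_combination b * hsines + b * sin (sideAngle φ a b) ^ 2 * cos (arctan a) ^ 2 * hone

theorem bigonTotal_strictMono_left (b : ℝ) : StrictMono fun a => bigonTotal φ a b := by
  refine strictMono_of_deriv_pos fun a => ?_
  rw [(hasDerivAt_bigonTotal_left hφ a b).deriv]
  have hangle := sideAngle_pos φ a b
  have hsin_lt := sin_lt (x := 2 * sideAngle φ a b) (by positivity)
  rw [sin_two_mul] at hsin_lt
  have := cos_arctan_pos a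
  have : 0 < sideAngle φ a b - sin (sideAngle φ a b) * cos (sideAngle φ a b) := by linarith
  positivity

theorem bigonTotal_strictMono_right (a : ℝ) : StrictMono (bigonTotal φ a) := by
  intro b b' hb
  simpa only [bigonTotal_comm φ a] using bigonTotal_strictMono_left hφ a hb

theorem bigonTotal_mono {a a' b b' : ℝ} (ha : a ≤ a') (hb : b ≤ b') :
    bigonTotal φ a b ≤ bigonTotal φ a' b' :=
  ((bigonTotal_strictMono_left hφ b).monotone ha).trans
    ((bigonTotal_strictMono_right hφ a').monotone hb)

theorem sideTotal_monotone_left {b : ℝ} (hb : 0 ≤ b) : Monotone fun a => sideTotal φ a b := by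
  intro a a' ha
  have htotal := (bigonTotal_strictMono_left hφ b).monotone ha
  have hother := sideTotal_antitone_right hφ hb ha
  simp only [bigonTotal] at htotal
  linarith

end

theorem tendsto_bigonTotal_right (hφ : φ ∈ Ioo 0 π) (a : ℝ) :
    Tendsto (bigonTotal φ a) atTop (𝓝 (2 * φ)) := by
  have h := (tendsto_sideTotal_right (sin_pos_of_mem_Ioo hφ) a).add (tendsto_sideTotal_left hφ a)
  rwa [zero_add] at h

theorem bigonTotal_lt (hφ : φ ∈ Ioo 0 π) (a b : ℝ) : bigonTotal φ a b < 2 * φ := by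
  have hmono := bigonTotal_strictMono_right (sin_pos_of_mem_Ioo hφ) a
  exact (hmono (lt_add_one b)).trans_le
    (hmono.monotone.ge_of_tendsto (tendsto_bigonTotal_right hφ a) _)

end Bigon

/-! ### Off-diagonally antitone systems of equations -/

section OffDiagAntitone

variable {ι : Type*} {T : (ι → ℝ) → ι → ℝ} {L : ι → ℝ}

/-- On nonnegative vectors, each component of `T` can only decrease when the variables of different
index increase (the sign pattern of an M-matrix, without differentiability). -/
def OffDiagAntitone (T : (ι → ℝ) → ι → ℝ) : Prop :=
  ∀ ⦃k k' : ι → ℝ⦄, 0 ≤ k → k ≤ k' → ∀ i, k i = k' i → T k' i ≤ T k i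

/-- The nonnegative vectors `k` with `T k ≤ L`; by Perron's method, a largest one solves
`T k = L`. -/
def subsolutions (T : (ι → ℝ) → ι → ℝ) (L : ι → ℝ) : Set (ι → ℝ) := {k | 0 ≤ k ∧ T k ≤ L}

theorem OffDiagAntitone.supClosed_subsolutions (hT : OffDiagAntitone T) :
    SupClosed (subsolutions T L) := by
  rintro k ⟨hk, hkL⟩ k' ⟨hk', hkL'⟩
  refine ⟨hk.trans le_sup_left, fun i => ?_⟩
  rcases le_total (k i) (k' i) with hi | hi
  · exact (hT hk' le_sup_right i (sup_of_le_right hi).symm).trans (hkL' i)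
  · exact (hT hk le_sup_left i (sup_of_le_left hi).symm).trans (hkL i)

theorem OffDiagAntitone.injOn [Fintype ι] (hT : OffDiagAntitone T)
    (hsum : StrictMonoOn (fun k => ∑ i, T k i) (Ici 0)) : InjOn T (Ici 0) := by
  have eq_of_le : ∀ k k', 0 ≤ k → k ≤ k' → T k' ≤ T k → k = k' := fun k k' hk hle hT' =>
    hle.eq_of_not_lt fun hlt => (hsum hk (hk.trans hle) hlt).not_ge
      (Finset.sum_le_sum fun i _ => hT' i)
  intro k hk k' hk' h
  have hsup : T (k ⊔ k') ≤ T k :=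
    (hT.supClosed_subsolutions ⟨hk, le_rfl⟩ ⟨hk', h.ge⟩).2
  calc k = k ⊔ k' := eq_of_le _ _ hk le_sup_left hsup
    _ = k' := (eq_of_le _ _ hk' le_sup_right (hsup.trans h.le)).symm

theorem OffDiagAntitone.exists_eq [Finite ι] (hT : OffDiagAntitone T) (hcont : Continuous T)
    (hne : (subsolutions T L).Nonempty) (hbdd : BddAbove (subsolutions T L)) :
    ∃ k, 0 ≤ k ∧ T k = L := by
  classical
  have := Fintype.ofFinite ι
  obtain ⟨B, hB⟩ := hbdd
  have hcompact : IsCompact (subsolutions T L) :=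
    (isCompact_Icc (a := 0) (b := B)).of_isClosed_subset
      (isClosed_Ici.inter (isClosed_le hcont continuous_const)) fun k hk => ⟨hk.1, hB hk⟩
  obtain ⟨k, ⟨hk, hkL⟩, hmax⟩ := hcompact.exists_isMaxOn hne
    (f := fun k => ∑ i, k i) (by fun_prop)
  refine ⟨k, hk, funext fun i => (hkL i).eq_of_not_lt fun hi => ?_⟩
  -- Otherwise `k i` could still be increased.
  have hbump : Continuous fun t => T (Function.update k i t) i :=
    (continuous_apply i).comp (hcont.comp (continuous_const.update i continuous_id))
  have hev : ∀ᶠ t in 𝓝[>] k i, T (Function.update k i t) i < L i :=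
    nhdsWithin_le_nhds ((hbump.tendsto (k i)).eventually_lt_const
      (by rwa [Function.update_eq_self]))
  obtain ⟨t, ht, hkt⟩ := (hev.and self_mem_nhdsWithin).exists
  have hlt : k < Function.update k i t := lt_update_self_iff.2 hkt
  have hmem : Function.update k i t ∈ subsolutions T L := by
    refine ⟨hk.trans hlt.le, fun j => ?_⟩
    rcases eq_or_ne j i with rfl | hj
    · exact ht.le
    · exact (hT hk hlt.le j (Function.update_of_ne hj t k).symm).trans (hkL j)
  exact (Fintype.sum_strictMono hlt).not_ge (hmax hmem)

theorem exists_mem_forall_le_of_supClosed {A : Set (ι → ℝ)} (hA : SupClosed A)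
    (hne : A.Nonempty) (U : Finset ι) (hU : ∀ i ∈ U, ¬ BddAbove (Function.eval i '' A)) (n : ℝ) :
    ∃ k ∈ A, ∀ i ∈ U, n ≤ k i := by
  classical
  induction U using Finset.induction_on with
  | empty => exact hne.imp fun k hk => ⟨hk, by simp⟩
  | insert i V _ ih =>
    obtain ⟨k, hk, hkV⟩ := ih fun j hj => hU j (Finset.mem_insert_of_mem hj)
    obtain ⟨_, ⟨k', hk', rfl⟩, hn⟩ := not_bddAbove_iff.1 (hU i (Finset.mem_insert_self i V)) n
    refine ⟨k ⊔ k', hA hk hk', fun j hj => ?_⟩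
    rcases Finset.mem_insert.1 hj with rfl | hj
    · exact le_sup_of_le_right hn.le
    · exact le_sup_of_le_left (hkV j hj)

end OffDiagAntitone

/-! ### The curvature map -/

section CurvatureMap

variable {E F : Type*} [Fintype E] (face : E → Bool → F) (Φ : E → ℝ)

open Classical in
/-- Total geodesic curvatures of the 2-cells as functions of the geodesic curvatures `k` of their
circles, where `face e false`, `face e true` are the 2-cells beside the 1-cell `e`. -/
def curvatureMap (k : F → ℝ) (f : F) : ℝ :=
  ∑ e : E, ∑ s : Bool, if face e s = f then
    sideTotal (Φ e) (k (face e s)) (k (face e (!s))) else 0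

open Classical in
/-- The set `E_{F'}` of the 1-cells on the boundary of some 2-cell in `F'`. -/
def incidentEdges (F' : Finset F) : Finset E :=
  Finset.univ.filter fun e => ∃ s, face e s ∈ F'

/-- The nonnegative vectors that satisfy the inequalities `∑_{f ∈ F'} L f < 2 ∑_{e ∈ E_{F'}} Φ e`
for all nonempty `F'`. -/
def admissibleCurvatures : Set (F → ℝ) :=
  {L | 0 ≤ L ∧ ∀ F' : Finset F, F'.Nonempty →
    ∑ f ∈ F', L f < 2 * ∑ e ∈ incidentEdges face F', Φ e}

variable {face Φ} {k : F → ℝ}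

theorem mem_incidentEdges {F' : Finset F} {e : E} :
    e ∈ incidentEdges face F' ↔ face e true ∈ F' ∨ face e false ∈ F' := by
  simp [incidentEdges, or_comm]

open Classical in
theorem sum_curvatureMap (k : F → ℝ) (F' : Finset F) :
    ∑ f ∈ F', curvatureMap face Φ k f = ∑ e ∈ incidentEdges face F',
      ((if face e true ∈ F' then sideTotal (Φ e) (k (face e true)) (k (face e false)) else 0) +
        if face e false ∈ F' then sideTotal (Φ e) (k (face e false)) (k (face e true)) else 0) := by
  simp only [curvatureMap, Fintype.sum_bool, Bool.not_true, Bool.not_false]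
  rw [Finset.sum_comm]
  simp only [Finset.sum_add_distrib, Finset.sum_ite_eq]
  rw [← Finset.sum_add_distrib, ← Finset.sum_add_distrib]
  refine (Finset.sum_subset (Finset.subset_univ _) fun e _ he => ?_).symm
  rw [mem_incidentEdges, not_or] at he
  rw [if_neg he.1, if_neg he.2, add_zero]

theorem sum_univ_curvatureMap [Fintype F] (k : F → ℝ) :
    ∑ f, curvatureMap face Φ k f =
      ∑ e, bigonTotal (Φ e) (k (face e true)) (k (face e false)) := by
  rw [sum_curvatureMap]
  simp [incidentEdges, bigonTotal]

theorem curvatureMap_nonneg (hk : 0 ≤ k) : 0 ≤ curvatureMap face Φ k := fun _ =>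
  Finset.sum_nonneg fun _ _ => Finset.sum_nonneg fun _ _ => by
    split_ifs
    exacts [sideTotal_nonneg _ (hk _) _, le_rfl]

theorem curvatureMap_eq_zero {f : F} (hf : k f = 0) : curvatureMap face Φ k f = 0 :=
  Finset.sum_eq_zero fun _ _ => Finset.sum_eq_zero fun _ _ => by
    split_ifs with h
    exacts [by rw [h, hf, sideTotal_zero], rfl]

theorem zero_mem_subsolutions_curvatureMap {L : F → ℝ} (hL : 0 ≤ L) :
    0 ∈ subsolutions (curvatureMap face Φ) L :=
  ⟨le_rfl, fun f => (curvatureMap_eq_zero (k := 0) rfl).trans_le (hL f)⟩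

theorem curvatureMap_eq_zero_iff (hface : ∀ f, ∃ e s, face e s = f) (hk : 0 ≤ k) {f : F} :
    curvatureMap face Φ k f = 0 ↔ k f = 0 := by
  classical
  refine ⟨fun h => ?_, curvatureMap_eq_zero⟩
  have hterm : ∀ e s, 0 ≤ if face e s = f then
      sideTotal (Φ e) (k (face e s)) (k (face e (!s))) else 0 := fun e s => by
    split_ifs
    exacts [sideTotal_nonneg _ (hk _) _, le_rfl]
  obtain ⟨e, s, hes⟩ := hface f
  have hsum := (Finset.sum_eq_zero_iff_of_nonneg fun e _ =>
    Finset.sum_nonneg fun s _ => hterm e s).1 h e (Finset.mem_univ e)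
  have hzero := (Finset.sum_eq_zero_iff_of_nonneg fun s _ => hterm e s).1 hsum s (Finset.mem_univ s)
  rw [if_pos hes, hes] at hzero
  exact (hk f).eq_of_not_lt' fun hlt => (sideTotal_pos _ hlt _).ne' hzero

open Classical in
theorem continuous_curvatureMap : Continuous (curvatureMap face Φ) := by
  refine continuous_pi fun f => ?_
  simp only [curvatureMap]
  refine continuous_finsetSum _ fun e _ => continuous_finsetSum _ fun s _ => ?_
  have hpair : Continuous fun k : F → ℝ => (k (face e s), k (face e (!s))) := by fun_prop
  have hside := (continuous_sideTotal (Φ e)).comp hpair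
  by_cases hf : face e s = f
  · simpa only [if_pos hf, Function.comp_def] using hside
  · simpa only [if_neg hf] using continuous_const

variable (hΦ : ∀ e, Φ e ∈ Ioo 0 π)
include hΦ

theorem offDiagAntitone_curvatureMap : OffDiagAntitone (curvatureMap face Φ) := by
  intro k k' hk hle f hf
  refine Finset.sum_le_sum fun e _ => Finset.sum_le_sum fun s _ => ?_
  split_ifs with h
  · rw [h, ← hf]
    exact sideTotal_antitone_right (sin_pos_of_mem_Ioo (hΦ e)) (hk f) (hle _)
  · exact le_rfl

theorem strictMono_sum_curvatureMap [Fintype F] (hface : ∀ f, ∃ e s, face e s = f) :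
    StrictMono fun k => ∑ f, curvatureMap face Φ k f := by
  intro k k' hlt
  simp only [sum_univ_curvatureMap]
  obtain ⟨hle, f, hf⟩ := Pi.lt_def.1 hlt
  obtain ⟨e, s, rfl⟩ := hface f
  have hsin := fun e => sin_pos_of_mem_Ioo (hΦ e)
  refine Finset.sum_lt_sum (fun e _ => bigonTotal_mono (hsin e) (hle _) (hle _))
    ⟨e, Finset.mem_univ e, ?_⟩
  cases s
  · exact (bigonTotal_strictMono_right (hsin e) _ hf).trans_le
      (bigonTotal_mono (hsin e) (hle _) le_rfl)
  · exact (bigonTotal_strictMono_left (hsin e) _ hf).trans_le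
      (bigonTotal_mono (hsin e) le_rfl (hle _))

theorem sum_curvatureMap_lt (hface : ∀ f, ∃ e s, face e s = f) (hk : 0 ≤ k) {F' : Finset F}
    (hF' : F'.Nonempty) :
    ∑ f ∈ F', curvatureMap face Φ k f < 2 * ∑ e ∈ incidentEdges face F', Φ e := by
  classical
  have hne : (incidentEdges face F').Nonempty := by
    obtain ⟨f, hf⟩ := hF'
    obtain ⟨e, s, rfl⟩ := hface f
    exact ⟨e, Finset.mem_filter.2 ⟨Finset.mem_univ e, s, hf⟩⟩
  rw [sum_curvatureMap, Finset.mul_sum]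
  refine Finset.sum_lt_sum_of_nonempty hne fun e _ => lt_of_le_of_lt ?_
    (bigonTotal_lt (hΦ e) (k (face e true)) (k (face e false)))
  have htrue := sideTotal_nonneg (Φ e) (hk (face e true)) (k (face e false))
  have hfalse := sideTotal_nonneg (Φ e) (hk (face e false)) (k (face e true))
  unfold bigonTotal
  split_ifs <;> linarith

theorem sum_sideTotal_le_sum_curvatureMap (hk : 0 ≤ k) {U : Finset F} {n B : ℝ} (hB : 0 ≤ B)
    (hBn : B ≤ n) (hU : ∀ f ∈ U, n ≤ k f) (hUc : ∀ f, f ∉ U → k f ≤ B) :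
    ∑ e ∈ incidentEdges face U, sideTotal (Φ e) n B ≤ ∑ f ∈ U, curvatureMap face Φ k f := by
  classical
  rw [sum_curvatureMap]
  refine Finset.sum_le_sum fun e he => ?_
  have hsin := sin_pos_of_mem_Ioo (hΦ e)
  have one_side : ∀ f f', f ∈ U → f' ∉ U → sideTotal (Φ e) n B ≤ sideTotal (Φ e) (k f) (k f') :=
    fun f f' hf hf' => (sideTotal_monotone_left hsin hB (hU f hf)).trans
      (sideTotal_antitone_right hsin (hk f) (hUc f' hf'))
  have both_sides : ∀ f f', f ∈ U → f' ∈ U → sideTotal (Φ e) n B ≤ bigonTotal (Φ e) (k f) (k f') :=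
    fun f f' hf hf' => (le_add_of_nonneg_right (sideTotal_nonneg _ hB n)).trans
      (bigonTotal_mono hsin (hU f hf) (hBn.trans (hU f' hf')))
  by_cases htrue : face e true ∈ U <;> by_cases hfalse : face e false ∈ U
  · rw [if_pos htrue, if_pos hfalse]
    exact both_sides _ _ htrue hfalse
  · rw [if_pos htrue, if_neg hfalse, add_zero]
    exact one_side _ _ htrue hfalse
  · rw [if_neg htrue, if_pos hfalse, zero_add]
    exact one_side _ _ hfalse htrue
  · exact absurd (mem_incidentEdges.1 he) (not_or.2 ⟨htrue, hfalse⟩)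

theorem bddAbove_subsolutions_curvatureMap [Finite F] {L : F → ℝ}
    (hL : L ∈ admissibleCurvatures face Φ) :
    BddAbove (subsolutions (curvatureMap face Φ) L) := by
  classical
  have := Fintype.ofFinite F
  set A := subsolutions (curvatureMap face Φ) L
  have hzero : (0 : F → ℝ) ∈ A := zero_mem_subsolutions_curvatureMap hL.1
  -- If the variables in `U` are unbounded on `A`, then the total curvature of `U` comes arbitrarily
  -- close to its supremum `2 ∑ Φ` on `A`.
  let U : Finset F := Finset.univ.filter fun f => ¬ BddAbove (Function.eval f '' A)
  obtain ⟨B, hB⟩ : BddAbove (⋃ f ∈ {f | f ∉ U}, Function.eval f '' A) :=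
    (toFinite _).bddAbove_biUnion.2 fun f hf => by simpa [U] using hf
  suffices hU : U = ∅ from bddAbove_pi.2 fun f => by
    simpa [U] using Finset.filter_eq_empty_iff.1 hU (Finset.mem_univ f)
  by_contra hU
  have hbound : ∀ n, max B 0 ≤ n →
      ∑ e ∈ incidentEdges face U, sideTotal (Φ e) n (max B 0) ≤ ∑ f ∈ U, L f := by
    intro n hn
    obtain ⟨k, hk, hkU⟩ := exists_mem_forall_le_of_supClosed
      (offDiagAntitone_curvatureMap hΦ).supClosed_subsolutions ⟨0, hzero⟩ U
      (fun f hf => (Finset.mem_filter.1 hf).2) n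
    exact (sum_sideTotal_le_sum_curvatureMap hΦ hk.1 (le_max_right B 0) hn hkU fun f hf =>
      le_max_of_le_left (hB (mem_biUnion hf (mem_image_of_mem _ hk)))).trans
      (Finset.sum_le_sum fun f _ => hk.2 f)
  have hlim : Tendsto (fun n => ∑ e ∈ incidentEdges face U, sideTotal (Φ e) n (max B 0)) atTop
      (𝓝 (2 * ∑ e ∈ incidentEdges face U, Φ e)) := by
    rw [Finset.mul_sum]
    exact tendsto_finsetSum _ fun e _ => tendsto_sideTotal_left (hΦ e) _
  exact (le_of_tendsto hlim (eventually_atTop.2 ⟨_, hbound⟩)).not_gt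
    (hL.2 U (Finset.nonempty_iff_ne_empty.2 hU))

theorem bijOn_curvatureMap [Finite F] (hface : ∀ f, ∃ e s, face e s = f) :
    BijOn (curvatureMap face Φ) (Ici 0) (admissibleCurvatures face Φ) := by
  have := Fintype.ofFinite F
  have hanti : OffDiagAntitone (curvatureMap face Φ) := offDiagAntitone_curvatureMap hΦ
  refine ⟨fun k hk => ⟨curvatureMap_nonneg hk, fun F' => sum_curvatureMap_lt hΦ hface hk⟩,
    hanti.injOn ((strictMono_sum_curvatureMap hΦ hface).strictMonoOn _), fun L hL => ?_⟩
  exact hanti.exists_eq continuous_curvatureMap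
    ⟨0, zero_mem_subsolutions_curvatureMap hL.1⟩ (bddAbove_subsolutions_curvatureMap hΦ hL)

end CurvatureMap

/-! ### Spherical trigonometry of two disks -/

section Trigonometry

variable {φ r₁ r₂ : ℝ}

theorem sin_pos_of_mem_Ioc {r : ℝ} (hr : r ∈ Ioc 0 (π / 2)) : 0 < sin r :=
  sin_pos_of_pos_of_lt_pi hr.1 (by linarith [hr.2, pi_pos])

theorem cos_nonneg_of_mem_Ioc {r : ℝ} (hr : r ∈ Ioc 0 (π / 2)) : 0 ≤ cos r :=
  cos_nonneg_of_mem_Icc ⟨by linarith [hr.1, pi_pos], hr.2⟩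

-- The squares are those of `cos d`, `sin d cos θ`, `sin d sin θ`, the coordinates of the second
-- center in an orthonormal frame at the first one (`d` the distance of the centers, `θ` the half
-- angle).
theorem sq_add_sq_add_sq_eq_one (φ r₁ r₂ : ℝ) :
    (cos r₁ * cos r₂ - sin r₁ * sin r₂ * cos φ) ^ 2 +
      (sin r₁ * cos r₂ + cos r₁ * sin r₂ * cos φ) ^ 2 + (sin r₂ * sin φ) ^ 2 = 1 := by
  linear_combination (cos r₂ ^ 2 + sin r₂ ^ 2 * cos φ ^ 2) * sin_sq_add_cos_sq r₁ +
    sin_sq_add_cos_sq r₂ + sin r₂ ^ 2 * sin_sq_add_cos_sq φ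

theorem cos_centerDist (φ r₁ r₂ : ℝ) :
    cos (centerDist φ r₁ r₂) = cos r₁ * cos r₂ - sin r₁ * sin r₂ * cos φ := by
  have h := abs_le_one_iff_mul_self_le_one.2 (by
    nlinarith [sq_add_sq_add_sq_eq_one φ r₁ r₂] :
      (cos r₁ * cos r₂ - sin r₁ * sin r₂ * cos φ) *
        (cos r₁ * cos r₂ - sin r₁ * sin r₂ * cos φ) ≤ 1)
  exact cos_arccos (abs_le.1 h).1 (abs_le.1 h).2

theorem sq_sin_centerDist (φ r₁ r₂ : ℝ) : sin (centerDist φ r₁ r₂) ^ 2 =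
    (sin r₁ * cos r₂ + cos r₁ * sin r₂ * cos φ) ^ 2 + (sin r₂ * sin φ) ^ 2 := by
  rw [sin_sq, cos_centerDist]
  linear_combination -sq_add_sq_add_sq_eq_one φ r₁ r₂

theorem sin_centerDist_pos (hφ : 0 < sin φ) (h₂ : 0 < sin r₂) :
    0 < sin (centerDist φ r₁ r₂) := by
  refine (sin_nonneg_of_nonneg_of_le_pi (arccos_nonneg _) (arccos_le_pi _)).lt_of_ne'
    fun h : sin (centerDist φ r₁ r₂) = 0 => ?_
  have hsq := sq_sin_centerDist φ r₁ r₂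
  rw [h] at hsq
  nlinarith [sq_pos_of_pos (mul_pos h₂ hφ),
    sq_nonneg (sin r₁ * cos r₂ + cos r₁ * sin r₂ * cos φ)]

variable (hφ : 0 < sin φ) (h₁ : 0 < sin r₁) (h₂ : 0 < sin r₂)
include hφ h₁ h₂

theorem sin_centerDist_mul_cos_halfAngle :
    sin (centerDist φ r₁ r₂) * cos (halfAngle φ r₁ r₂) =
      sin r₁ * cos r₂ + cos r₁ * sin r₂ * cos φ := by
  have hd : 0 < sin (centerDist φ r₁ r₂) := sin_centerDist_pos hφ h₂
  have hnum : cos r₂ - cos r₁ * (cos r₁ * cos r₂ - sin r₁ * sin r₂ * cos φ) =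
      sin r₁ * (sin r₁ * cos r₂ + cos r₁ * sin r₂ * cos φ) := by
    linear_combination (-cos r₂) * sin_sq_add_cos_sq r₁
  rw [halfAngle, cos_centerDist, hnum, mul_div_mul_left _ _ h₁.ne']
  have hle := abs_le_of_sq_le_sq' (a := sin r₁ * cos r₂ + cos r₁ * sin r₂ * cos φ)
    (by nlinarith [sq_sin_centerDist φ r₁ r₂, sq_nonneg (sin r₂ * sin φ)]) hd.le
  rw [cos_arccos (by rw [le_div_iff₀ hd]; linarith) (by rw [div_le_one hd]; exact hle.2),
    mul_div_cancel₀ _ hd.ne']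

theorem sin_centerDist_mul_sin_halfAngle :
    sin (centerDist φ r₁ r₂) * sin (halfAngle φ r₁ r₂) = sin r₂ * sin φ := by
  have hd : 0 < sin (centerDist φ r₁ r₂) := sin_centerDist_pos hφ h₂
  have hθ : 0 ≤ sin (halfAngle φ r₁ r₂) :=
    sin_nonneg_of_nonneg_of_le_pi (arccos_nonneg _) (arccos_le_pi _)
  rw [← sq_eq_sq₀ (by positivity) (by positivity), mul_pow, sin_sq (halfAngle φ r₁ r₂), mul_sub,
    mul_one, ← mul_pow, sin_centerDist_mul_cos_halfAngle hφ h₁ h₂, sq_sin_centerDist]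
  ring

theorem sin_halfAngle_pos : 0 < sin (halfAngle φ r₁ r₂) :=
  pos_of_mul_pos_right (a := sin (centerDist φ r₁ r₂))
    (by rw [sin_centerDist_mul_sin_halfAngle hφ h₁ h₂]; positivity)
    (sin_centerDist_pos hφ h₂).le

theorem halfAngle_eq_sideAngle (hr₁ : r₁ ∈ Ioo 0 π) :
    halfAngle φ r₁ r₂ = sideAngle φ (cot r₁) (cot r₂) := by
  have hθ := sin_halfAngle_pos hφ h₁ h₂
  have hpos : 0 < halfAngle φ r₁ r₂ := (arccos_nonneg _).lt_of_ne'
      fun h : halfAngle φ r₁ r₂ = 0 => by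
    rw [h, sin_zero] at hθ
    exact hθ.false
  have hlt : halfAngle φ r₁ r₂ < π := (arccos_le_pi _).lt_of_ne
      fun h : halfAngle φ r₁ r₂ = π => by
    rw [h, sin_pi] at hθ
    exact hθ.false
  rw [← arccot_cot hpos hlt, sideAngle, cotSideAngle, sin_arctan_cot hr₁.1 hr₁.2,
    cos_arctan_cot hr₁.1 hr₁.2]
  congr 1
  have hd : 0 < sin (centerDist φ r₁ r₂) := sin_centerDist_pos hφ h₂
  calc cot (halfAngle φ r₁ r₂)
      = sin (centerDist φ r₁ r₂) * cos (halfAngle φ r₁ r₂) /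
          (sin (centerDist φ r₁ r₂) * sin (halfAngle φ r₁ r₂)) := by
        rw [cot_eq_cos_div_sin, mul_div_mul_left _ _ hd.ne']
    _ = (sin r₁ * cos r₂ + cos r₁ * sin r₂ * cos φ) / (sin r₂ * sin φ) := by
        rw [sin_centerDist_mul_cos_halfAngle hφ h₁ h₂, sin_centerDist_mul_sin_halfAngle hφ h₁ h₂]
    _ = (cot r₂ * sin r₁ + cos r₁ * cos φ) / sin φ := by
        rw [cot_eq_cos_div_sin]
        field_simp

theorem sideCurvature_eq_sideTotal (hr₁ : r₁ ∈ Ioo 0 π) :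
    sideCurvature φ r₁ r₂ = sideTotal φ (cot r₁) (cot r₂) := by
  rw [sideCurvature, sideLength, halfAngle_eq_sideAngle hφ h₁ h₂ hr₁, sideTotal,
    sin_arctan_cot hr₁.1 hr₁.2, mul_assoc, cot_eq_cos_div_sin, mul_div_cancel₀ _ h₁.ne']

theorem inner_center_corner (s t : Bool) :
    inner ℝ (center φ r₁ r₂ s) (corner φ r₁ r₂ t) = cos (cond s r₂ r₁) := by
  cases s
  · simp [center, corner, PiLp.inner_apply, Fin.sum_univ_three]
  · simp only [center, corner, PiLp.inner_apply, Fin.sum_univ_three, cond_true]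
    simp only [Fin.isValue, Matrix.cons_val_zero, RCLike.inner_apply, conj_trivial,
      Matrix.cons_val_one, Matrix.cons_val, mul_zero, add_zero]
    linear_combination sin r₁ * sin_centerDist_mul_cos_halfAngle hφ h₁ h₂ +
      cos r₁ * cos_centerDist φ r₁ r₂ + cos r₂ * sin_sq_add_cos_sq r₁

end Trigonometry

/-! ### Homeomorphisms from the model quadrilateral to spherical kites -/

section Kite

theorem continuous_leg (s t : Bool) : Continuous (leg s t) := by
  unfold leg
  fun_prop

instance : CompactSpace Square := by
  have hclosed : IsClosed {x : ℝ × ℝ | |x.1| + |x.2| ≤ 1} :=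
    isClosed_le (by fun_prop) continuous_const
  refine isCompact_iff_compactSpace.1 (Metric.isCompact_of_isClosed_isBounded hclosed
    ((Metric.isBounded_closedBall (x := (0 : ℝ × ℝ)) (r := 1)).subset fun x hx => ?_))
  rw [mem_closedBall_zero_iff, Prod.norm_def, max_le_iff]
  exact ⟨(le_add_of_nonneg_right (abs_nonneg x.2)).trans hx,
    (le_add_of_nonneg_left (abs_nonneg x.1)).trans hx⟩

variable {V : Type*}

/-- The combination of two centers `P` and one of two corners `C`, chosen by the sign of `y`. -/
def kiteVec [AddCommGroup V] [Module ℝ V] (P C : Bool → V) (α β y : ℝ) : V :=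
  α • P false + β • P true + y⁻ • C false + y⁺ • C true

/-- The point of the flat kite with centers `P` and corners `C` that corresponds to a point of the
model quadrilateral; the map is affine on the upper and on the lower half. -/
def squareVec [AddCommGroup V] [Module ℝ V] (P C : Bool → V) (x : Square) : V :=
  kiteVec P C ((1 - |x.1.2| - x.1.1) / 2) ((1 - |x.1.2| + x.1.1) / 2) x.1.2

/-- The cone over the quadrilateral with centers `P` and corners `C` is three-dimensional and
convex along the diagonal `P false`, `P true`: the two corners are equally far from the plane of the
diagonal, on opposite sides of it, and the midpoint of the corners lies in the cone over the
diagonal. -/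
structure IsKite [AddCommGroup V] [Module ℝ V] (P C : Bool → V) : Prop where
  linearIndependent : LinearIndependent ℝ ![P false, P true, C true - C false]
  exists_add_eq : ∃ a b : ℝ, 0 ≤ a ∧ 0 ≤ b ∧ C false + C true = a • P false + b • P true

/-- The unit vectors in the convex cone spanned by the centers `P` and the corners `C`. -/
def sphericalHull [NormedAddCommGroup V] [NormedSpace ℝ V] (P C : Bool → V) : Set V :=
  {v | ‖v‖ = 1 ∧ ∃ a b c d : ℝ, 0 ≤ a ∧ 0 ≤ b ∧ 0 ≤ c ∧ 0 ≤ d ∧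
    v = a • P false + b • P true + c • C false + d • C true}

section Module

variable [AddCommGroup V] [Module ℝ V] {P C : Bool → V}

theorem smul_kiteVec {r : ℝ} (hr : 0 ≤ r) (α β y : ℝ) :
    r • kiteVec P C α β y = kiteVec P C (r * α) (r * β) (r * y) := by
  have hneg : (r * y)⁻ = r * y⁻ := by simp only [negPart_def, ← mul_neg, mul_max_of_nonneg _ _ hr,
    mul_zero]
  have hpos : (r * y)⁺ = r * y⁺ := by simp only [posPart_def, mul_max_of_nonneg _ _ hr, mul_zero]
  simp only [kiteVec, hneg, hpos, smul_add, smul_smul]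

theorem squareVec_leg (s t : Bool) (c : unitInterval) :
    squareVec P C (leg s t c) = (1 - (c : ℝ)) • P s + (c : ℝ) • C t := by
  have hc : 0 ≤ (c : ℝ) := c.2.1
  have hadd : (1 - (c : ℝ) + (1 - c)) / 2 = 1 - c := by ring
  have hsub : (1 - (c : ℝ) - (c - 1)) / 2 = 1 - c := by ring
  cases s <;> cases t <;>
    simp [squareVec, kiteVec, leg, sgn, abs_of_nonneg hc, hc, hadd, hsub]

namespace IsKite

variable (h : IsKite P C)
include h

theorem kiteVec_inj {α β y α' β' y' : ℝ} (heq : kiteVec P C α β y = kiteVec P C α' β' y') :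
    α = α' ∧ β = β' ∧ y = y' := by
  obtain ⟨a, b, -, -, hab⟩ := h.exists_add_eq
  have expand : ∀ α β y : ℝ, kiteVec P C α β y =
      (α + |y| / 2 * a) • P false + (β + |y| / 2 * b) • P true + (y / 2) • (C true - C false) := by
    intro α β y
    have hpos : y⁺ = |y| / 2 + y / 2 := by linarith [posPart_sub_negPart y, posPart_add_negPart y]
    have hneg : y⁻ = |y| / 2 - y / 2 := by linarith [posPart_sub_negPart y, posPart_add_negPart y]
    calc kiteVec P C α β y
        = α • P false + β • P true + (|y| / 2) • (C false + C true) +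
            (y / 2) • (C true - C false) := by
          rw [kiteVec, hpos, hneg]
          module
      _ = _ := by
          rw [hab]
          module
  rw [expand, expand] at heq
  have hcoeff := Fintype.linearIndependent_iff.1 h.linearIndependent
    ![α + |y| / 2 * a - (α' + |y'| / 2 * a), β + |y| / 2 * b - (β' + |y'| / 2 * b),
      y / 2 - y' / 2] (by
      rw [← sub_eq_zero.2 heq]
      simp only [Fin.sum_univ_three, Matrix.cons_val]
      module)
  have hα := hcoeff 0
  have hβ := hcoeff 1
  have hy : y / 2 - y' / 2 = 0 := hcoeff 2
  obtain rfl : y = y' := by linarith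
  simp only [Matrix.cons_val] at hα hβ
  exact ⟨by linarith, by linarith, rfl⟩

theorem squareVec_ne_zero (x : Square) : squareVec P C x ≠ 0 := by
  intro hx
  have hzero : kiteVec P C 0 0 0 = 0 := by simp [kiteVec]
  obtain ⟨hα, hβ, hy⟩ := h.kiteVec_inj (hx.trans hzero.symm)
  rw [hy, abs_zero] at hα hβ
  linarith

theorem eq_of_squareVec_eq_smul {x x' : Square} {r : ℝ} (hr : 0 ≤ r)
    (heq : squareVec P C x = r • squareVec P C x') : x = x' := by
  rw [squareVec, squareVec, smul_kiteVec hr] at heq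
  obtain ⟨hα, hβ, hy⟩ := h.kiteVec_inj heq
  have habs : |x.1.2| = r * |x'.1.2| := by rw [hy, abs_mul, abs_of_nonneg hr]
  obtain rfl : r = 1 := by linear_combination -(hα + hβ + habs)
  exact Subtype.ext (Prod.ext (by linear_combination hβ - hα) (by linear_combination hy))

theorem exists_kiteVec_eq {a b c d : ℝ} (ha : 0 ≤ a) (hb : 0 ≤ b) (hc : 0 ≤ c) (hd : 0 ≤ d) :
    ∃ α β y : ℝ, 0 ≤ α ∧ 0 ≤ β ∧
      a • P false + b • P true + c • C false + d • C true = kiteVec P C α β y := by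
  obtain ⟨a', b', ha', hb', hab⟩ := h.exists_add_eq
  have : 0 ≤ min c d := le_min hc hd
  refine ⟨a + min c d * a', b + min c d * b', d - c, by positivity, by positivity, ?_⟩
  obtain ⟨hneg, hpos⟩ : (d - c)⁻ = c - min c d ∧ (d - c)⁺ = d - min c d := by
    rcases le_total c d with hcd | hcd <;> simp [hcd]
  calc a • P false + b • P true + c • C false + d • C true
      = a • P false + b • P true + min c d • (C false + C true) +
          (c - min c d) • C false + (d - min c d) • C true := by module
    _ = _ := by
        rw [hab, kiteVec, hneg, hpos]
        module

end IsKite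

theorem exists_smul_squareVec_eq_kiteVec {α β y : ℝ} (hα : 0 ≤ α) (hβ : 0 ≤ β)
    (hne : kiteVec P C α β y ≠ 0) :
    ∃ (r : ℝ) (x : Square), 0 < r ∧ r • squareVec P C x = kiteVec P C α β y := by
  have hr : 0 < α + β + |y| := by
    refine (by positivity : 0 ≤ α + β + |y|).lt_of_ne' fun hzero => hne ?_
    obtain rfl : y = 0 := abs_eq_zero.1 (by linarith [abs_nonneg y])
    rw [abs_zero] at hzero
    obtain ⟨rfl, rfl⟩ : α = 0 ∧ β = 0 := ⟨by linarith, by linarith⟩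
    simp [kiteVec]
  set r := α + β + |y|
  have habs : |y / r| = |y| / r := by rw [abs_div, abs_of_pos hr]
  refine ⟨r, ⟨((β - α) / r, y / r), ?_⟩, hr, ?_⟩
  · rw [habs, abs_div, abs_of_pos hr, ← add_div, div_le_one hr]
    exact add_le_add_left (abs_le.2 ⟨by linarith, by linarith⟩) |y|
  · rw [squareVec, smul_kiteVec hr.le]
    simp only [habs]
    congr 1 <;> field_simp <;> linarith

end Module

section NormedSpace

open NormedSpace

variable [NormedAddCommGroup V] [NormedSpace ℝ V] {P C : Bool → V}

theorem continuous_squareVec : Continuous (squareVec P C) := by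
  unfold squareVec kiteVec
  simp only [posPart_def, negPart_def]
  fun_prop

theorem normalize_squareVec_mem_sphericalHull {x : Square} (hx : squareVec P C x ≠ 0) :
    normalize (squareVec P C x) ∈ sphericalHull P C := by
  have habs := abs_le.1 (le_sub_iff_add_le.2 x.2)
  have hα : 0 ≤ (1 - |x.1.2| - x.1.1) / 2 := by linarith
  have hβ : 0 ≤ (1 - |x.1.2| + x.1.1) / 2 := by linarith
  have hinv : 0 ≤ ‖squareVec P C x‖⁻¹ := inv_nonneg.2 (norm_nonneg _)
  refine ⟨norm_normalize_eq_one_iff.2 hx, _, _, _, _, mul_nonneg hinv hα, mul_nonneg hinv hβ,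
    mul_nonneg hinv (negPart_nonneg x.1.2), mul_nonneg hinv (posPart_nonneg x.1.2), ?_⟩
  rw [NormedSpace.normalize]
  nth_rw 2 [squareVec]
  simp only [kiteVec, smul_add, smul_smul]

namespace IsKite

theorem bijective_normalize_squareVec (h : IsKite P C) :
    Function.Bijective fun x => (⟨normalize (squareVec P C x),
      normalize_squareVec_mem_sphericalHull (h.squareVec_ne_zero x)⟩ : sphericalHull P C) := by
  constructor
  · intro x x' heq
    have hray : SameRay ℝ (squareVec P C x') (squareVec P C x) :=
      (sameRay_iff_inv_norm_smul_eq_of_ne (h.squareVec_ne_zero x') (h.squareVec_ne_zero x)).2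
        (congrArg Subtype.val heq).symm
    obtain ⟨r, hr, hrx⟩ := hray.exists_pos_left (h.squareVec_ne_zero x') (h.squareVec_ne_zero x)
    exact h.eq_of_squareVec_eq_smul hr.le hrx.symm
  · rintro ⟨v, hv, a, b, c, d, ha, hb, hc, hd, hsum⟩
    obtain ⟨α, β, y, hα, hβ, hkite⟩ := h.exists_kiteVec_eq ha hb hc hd
    rw [hkite] at hsum
    have hne : kiteVec P C α β y ≠ 0 := fun hzero => by
      rw [hsum, hzero, norm_zero] at hv
      exact zero_ne_one hv
    obtain ⟨r, x, hr, hx⟩ := exists_smul_squareVec_eq_kiteVec hα hβ hne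
    refine ⟨x, Subtype.ext ?_⟩
    calc normalize (squareVec P C x) = normalize (r • squareVec P C x) :=
          (normalize_smul_of_pos hr _).symm
      _ = v := by rw [hx, ← hsum, normalize_eq_self_of_norm_eq_one hv]

/-- The central projection of the flat kite to the sphere. -/
def homeomorph (h : IsKite P C) : Square ≃ₜ sphericalHull P C :=
  Continuous.homeoOfEquivCompactToT2 (f := Equiv.ofBijective _ h.bijective_normalize_squareVec)
    (((continuous_squareVec.norm.inv₀ fun x => norm_ne_zero_iff.2 (h.squareVec_ne_zero x)).smul
      continuous_squareVec).subtype_mk _)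

theorem homeomorph_leg (h : IsKite P C) (s t : Bool) (c : unitInterval) :
    (h.homeomorph (leg s t c) : V) = normalize ((1 - (c : ℝ)) • P s + (c : ℝ) • C t) := by
  rw [← squareVec_leg]
  rfl

theorem homeomorph_leg_zero (h : IsKite P C) {s : Bool} (hs : ‖P s‖ = 1) (t : Bool) :
    (h.homeomorph (leg s t 0) : V) = P s := by
  simp [homeomorph_leg, normalize_eq_self_of_norm_eq_one hs]

theorem homeomorph_leg_one (h : IsKite P C) (s : Bool) {t : Bool} (ht : ‖C t‖ = 1) :
    (h.homeomorph (leg s t 1) : V) = C t := by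
  simp [homeomorph_leg, normalize_eq_self_of_norm_eq_one ht]

end IsKite

end NormedSpace

section InnerProductSpace

variable [NormedAddCommGroup V] [InnerProductSpace ℝ V]

theorem IsKite.angle_homeomorph_leg {P C : Bool → V} (h : IsKite P C) (s t : Bool)
    (c : unitInterval) :
    angle (P s) (h.homeomorph (leg s t c)) + angle (h.homeomorph (leg s t c) : V) (C t) =
      angle (P s) (C t) := by
  rw [h.homeomorph_leg, angle_normalize_right, angle_normalize_left]
  refine (angle_eq_angle_add_add_angle_add_of_mem_span ?_ ?_).symm
  · rw [← squareVec_leg]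
    exact h.squareVec_ne_zero _
  · exact Submodule.mem_span_pair.2
      ⟨⟨1 - c, sub_nonneg.2 c.2.2⟩, ⟨c, c.2.1⟩, rfl⟩

theorem angle_combination_congr {p q p' q' : V} (hp : ‖p‖ = ‖p'‖) (hq : ‖q‖ = ‖q'‖)
    (hpq : inner ℝ p q = inner ℝ p' q') (a b : ℝ) :
    angle p (a • p + b • q) = angle p' (a • p' + b • q') := by
  have hnorm : ‖a • p + b • q‖ = ‖a • p' + b • q'‖ := by
    rw [← sq_eq_sq₀ (norm_nonneg _) (norm_nonneg _), norm_add_sq_real, norm_add_sq_real]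
    simp only [norm_smul, real_inner_smul_left, real_inner_smul_right, hp, hq, hpq]
  simp only [angle, inner_add_right, real_inner_smul_right, real_inner_self_eq_norm_sq, hp, hpq,
    hnorm]

end InnerProductSpace

end Kite

/-! ### The spherical quadrilateral of two disks -/

section Quad

variable {φ r₁ r₂ : ℝ}

theorem norm_center (φ r₁ r₂ : ℝ) (s : Bool) : ‖center φ r₁ r₂ s‖ = 1 := by
  cases s <;> simp [center, EuclideanSpace.norm_eq, Fin.sum_univ_three]

theorem norm_corner (φ r₁ r₂ : ℝ) (t : Bool) : ‖corner φ r₁ r₂ t‖ = 1 := by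
  have hsgn : sgn t ^ 2 = 1 := by rw [← sq_abs, abs_sgn, one_pow]
  rw [EuclideanSpace.norm_eq, sqrt_eq_one]
  simp only [corner, Fin.sum_univ_three, norm_eq_abs, sq_abs, Matrix.cons_val]
  linear_combination sin r₁ ^ 2 * sin_sq_add_cos_sq (halfAngle φ r₁ r₂) + sin_sq_add_cos_sq r₁ +
    (sin r₁ * sin (halfAngle φ r₁ r₂)) ^ 2 * hsgn

theorem linearIndependent_center_corner (hφ : 0 < sin φ) (h₁ : 0 < sin r₁) (h₂ : 0 < sin r₂) :
    LinearIndependent ℝ ![center φ r₁ r₂ false, center φ r₁ r₂ true,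
      corner φ r₁ r₂ true - corner φ r₁ r₂ false] := by
  have hd : sin (centerDist φ r₁ r₂) ≠ 0 := (sin_centerDist_pos hφ h₂).ne'
  have hθ : sin (halfAngle φ r₁ r₂) ≠ 0 := (sin_halfAngle_pos hφ h₁ h₂).ne'
  refine Fintype.linearIndependent_iff.2 fun g hg => ?_
  have hcoord := fun i : Fin 3 => congrArg (fun v : E3 => v i) hg
  have h0 : g 0 + g 1 * cos (centerDist φ r₁ r₂) = 0 := by
    simpa [Fin.sum_univ_three, center, corner] using hcoord 0
  have h1 : g 1 = 0 := by
    simpa [Fin.sum_univ_three, center, corner, hd] using hcoord 1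
  have h2 : g 2 = 0 := by
    simpa [Fin.sum_univ_three, center, corner, sgn, h₁.ne', hθ, ← two_mul] using hcoord 2
  rw [h1, zero_mul, add_zero] at h0
  intro i
  fin_cases i <;> assumption

theorem corner_add_corner (hd : sin (centerDist φ r₁ r₂) ≠ 0) :
    corner φ r₁ r₂ false + corner φ r₁ r₂ true =
      (2 * (cos r₁ * sin (centerDist φ r₁ r₂) -
        sin r₁ * cos (halfAngle φ r₁ r₂) * cos (centerDist φ r₁ r₂)) /
          sin (centerDist φ r₁ r₂)) • center φ r₁ r₂ false +
      (2 * (sin r₁ * cos (halfAngle φ r₁ r₂)) / sin (centerDist φ r₁ r₂)) •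
        center φ r₁ r₂ true := by
  ext i
  fin_cases i <;> simp [center, corner, sgn] <;> field_simp <;> ring

variable (hφ : φ ∈ Ioc 0 (π / 2)) (hr₁ : r₁ ∈ Ioc 0 (π / 2)) (hr₂ : r₂ ∈ Ioc 0 (π / 2))
include hφ hr₁ hr₂

theorem cos_halfAngle_nonneg : 0 ≤ cos (halfAngle φ r₁ r₂) := by
  have hsφ := sin_pos_of_mem_Ioc hφ
  have hs₁ := sin_pos_of_mem_Ioc hr₁
  have hs₂ := sin_pos_of_mem_Ioc hr₂
  have hcφ := cos_nonneg_of_mem_Ioc hφ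
  have hc₁ := cos_nonneg_of_mem_Ioc hr₁
  have hc₂ := cos_nonneg_of_mem_Ioc hr₂
  refine nonneg_of_mul_nonneg_right ?_ (sin_centerDist_pos (r₁ := r₁) hsφ hs₂)
  rw [sin_centerDist_mul_cos_halfAngle hsφ hs₁ hs₂]
  positivity

theorem cos_mul_sin_centerDist_sub_nonneg : 0 ≤ cos r₁ * sin (centerDist φ r₁ r₂) -
    sin r₁ * cos (halfAngle φ r₁ r₂) * cos (centerDist φ r₁ r₂) := by
  have hsφ := sin_pos_of_mem_Ioc hφ
  have hs₁ := sin_pos_of_mem_Ioc hr₁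
  have hs₂ := sin_pos_of_mem_Ioc hr₂
  have hcφ := cos_nonneg_of_mem_Ioc hφ
  have hc₁ := cos_nonneg_of_mem_Ioc hr₁
  have hc₂ := cos_nonneg_of_mem_Ioc hr₂
  have heq : sin (centerDist φ r₁ r₂) * (cos r₁ * sin (centerDist φ r₁ r₂) -
      sin r₁ * cos (halfAngle φ r₁ r₂) * cos (centerDist φ r₁ r₂)) =
      sin r₂ * (sin r₂ * cos r₁ + cos r₂ * sin r₁ * cos φ) := by
    linear_combination cos r₁ * sin_sq_add_cos_sq (centerDist φ r₁ r₂) -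
      sin r₁ * cos (centerDist φ r₁ r₂) * sin_centerDist_mul_cos_halfAngle hsφ hs₁ hs₂ -
      (cos (centerDist φ r₁ r₂) * cos r₁ + cos r₂) * cos_centerDist φ r₁ r₂ -
      cos (centerDist φ r₁ r₂) * cos r₂ * sin_sq_add_cos_sq r₁ -
      cos r₁ * sin_sq_add_cos_sq r₂
  refine nonneg_of_mul_nonneg_right ?_ (sin_centerDist_pos (r₁ := r₁) hsφ hs₂)
  rw [heq]
  positivity

theorem isKite_center_corner : IsKite (center φ r₁ r₂) (corner φ r₁ r₂) := by
  have hsφ := sin_pos_of_mem_Ioc hφ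
  have hs₁ := sin_pos_of_mem_Ioc hr₁
  have hs₂ := sin_pos_of_mem_Ioc hr₂
  have hd := sin_centerDist_pos (r₁ := r₁) hsφ hs₂
  exact ⟨linearIndependent_center_corner hsφ hs₁ hs₂, _, _,
    div_nonneg (mul_nonneg two_pos.le (cos_mul_sin_centerDist_sub_nonneg hφ hr₁ hr₂)) hd.le,
    div_nonneg (mul_nonneg two_pos.le (mul_nonneg hs₁.le (cos_halfAngle_nonneg hφ hr₁ hr₂))) hd.le,
    corner_add_corner hd.ne'⟩

/-- The identification of the model quadrilateral with the spherical quadrilateral of two disks. -/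
def quadHomeomorph : Square ≃ₜ quad φ r₁ r₂ := (isKite_center_corner hφ hr₁ hr₂).homeomorph

theorem quadHomeomorph_leg (s t : Bool) (c : unitInterval) :
    (quadHomeomorph hφ hr₁ hr₂ (leg s t c) : E3) = NormedSpace.normalize
      ((1 - (c : ℝ)) • center φ r₁ r₂ s + (c : ℝ) • corner φ r₁ r₂ t) :=
  IsKite.homeomorph_leg _ s t c

theorem quadHomeomorph_leg_zero (s t : Bool) :
    (quadHomeomorph hφ hr₁ hr₂ (leg s t 0) : E3) = center φ r₁ r₂ s :=
  IsKite.homeomorph_leg_zero _ (norm_center φ r₁ r₂ s) t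

theorem quadHomeomorph_leg_one (s t : Bool) :
    (quadHomeomorph hφ hr₁ hr₂ (leg s t 1) : E3) = corner φ r₁ r₂ t :=
  IsKite.homeomorph_leg_one _ s (norm_corner φ r₁ r₂ t)

theorem angle_quadHomeomorph_leg (s t : Bool) (c : unitInterval) :
    angle (quadHomeomorph hφ hr₁ hr₂ (leg s t 0) : E3) (quadHomeomorph hφ hr₁ hr₂ (leg s t c)) +
        angle (quadHomeomorph hφ hr₁ hr₂ (leg s t c) : E3)
          (quadHomeomorph hφ hr₁ hr₂ (leg s t 1)) =
      angle (quadHomeomorph hφ hr₁ hr₂ (leg s t 0) : E3)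
        (quadHomeomorph hφ hr₁ hr₂ (leg s t 1)) := by
  rw [quadHomeomorph_leg_zero, quadHomeomorph_leg_one]
  exact IsKite.angle_homeomorph_leg _ s t c

theorem angle_quadHomeomorph_leg_congr {φ' r₁' r₂' : ℝ} (hφ' : φ' ∈ Ioc 0 (π / 2))
    (hr₁' : r₁' ∈ Ioc 0 (π / 2)) (hr₂' : r₂' ∈ Ioc 0 (π / 2)) {s s' : Bool}
    (hs : cond s r₂ r₁ = cond s' r₂' r₁') (t t' : Bool) (c : unitInterval) :
    angle (quadHomeomorph hφ hr₁ hr₂ (leg s t 0) : E3) (quadHomeomorph hφ hr₁ hr₂ (leg s t c)) =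
      angle (quadHomeomorph hφ' hr₁' hr₂' (leg s' t' 0) : E3)
        (quadHomeomorph hφ' hr₁' hr₂' (leg s' t' c)) := by
  have inner_eq : inner ℝ (center φ r₁ r₂ s) (corner φ r₁ r₂ t) =
      inner ℝ (center φ' r₁' r₂' s') (corner φ' r₁' r₂' t') := by
    rw [inner_center_corner (sin_pos_of_mem_Ioc hφ) (sin_pos_of_mem_Ioc hr₁)
      (sin_pos_of_mem_Ioc hr₂), inner_center_corner (sin_pos_of_mem_Ioc hφ')
      (sin_pos_of_mem_Ioc hr₁') (sin_pos_of_mem_Ioc hr₂'), hs]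
  rw [quadHomeomorph_leg_zero, quadHomeomorph_leg_zero, quadHomeomorph_leg, quadHomeomorph_leg,
    angle_normalize_right, angle_normalize_right]
  exact angle_combination_congr (by rw [norm_center, norm_center])
    (by rw [norm_corner, norm_corner]) inner_eq _ _

end Quad

/-! ### Isometries between metrics with equal radii -/

theorem eq_of_angle_eq {V : Type*} [NormedAddCommGroup V] [InnerProductSpace ℝ V] {c n p q : V}
    (hp : ‖p‖ = 1) (hq : ‖q‖ = 1) (hcn : angle c n ≠ π)
    (hpadd : angle c p + angle p n = angle c n) (hqadd : angle c q + angle q n = angle c n)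
    (hpq : angle c p = angle c q) : p = q := by
  have hp0 : p ≠ 0 := norm_ne_zero_iff.1 (hp.trans_ne one_ne_zero)
  have hq0 : q ≠ 0 := norm_ne_zero_iff.1 (hq.trans_ne one_ne_zero)
  obtain ⟨a, b, hab⟩ := Submodule.mem_span_pair.1
    (((angle_eq_angle_add_angle_iff hp0).1 hpadd.symm).resolve_left hcn)
  obtain ⟨a', b', hab'⟩ := Submodule.mem_span_pair.1
    (((angle_eq_angle_add_angle_iff hq0).1 hqadd.symm).resolve_left hcn)
  have inner_eq_zero : ∀ z, angle p z = angle q z → inner ℝ (p - q) z = 0 := by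
    intro z hz
    rw [inner_sub_left, ← cos_angle_mul_norm_mul_norm, ← cos_angle_mul_norm_mul_norm, hz, hp, hq,
      sub_self]
  have hc := inner_eq_zero c (by rw [angle_comm, hpq, angle_comm])
  have hn := inner_eq_zero n (by linarith)
  refine sub_eq_zero.1 (inner_self_eq_zero (𝕜 := ℝ).1 ?_)
  nth_rw 2 [← hab, ← hab']
  simp only [NNReal.smul_def, inner_sub_right, inner_add_right, real_inner_smul_right, hc, hn,
    mul_zero, add_zero, sub_zero]

namespace CellDecomposition

variable {S : Type*} [TopologicalSpace S] {E F : Type*} (D : CellDecomposition S E F)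

theorem face_eq_of_next {e e' : E} {s t s' t' : Bool} (h : D.next (e, s, t) = (e', s', t')) :
    D.face e s = D.face e' s' :=
  (D.face_eq_iff e s e' s').2 (.rel _ _ ⟨t, t', h⟩)

theorem isQuotientMap_chart [Finite E] [T2Space S] :
    Topology.IsQuotientMap fun p : Σ _ : E, Square => D.chart p.1 p.2 := by
  have hcont : Continuous fun p : Σ _ : E, Square => D.chart p.1 p.2 :=
    continuous_sigma D.continuous_chart
  refine hcont.isClosedMap.isQuotientMap hcont fun p => ?_
  obtain ⟨e, x, rfl⟩ := D.chart_surjective p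
  exact ⟨⟨e, x⟩, rfl⟩

theorem exists_continuousMap [Finite E] [T2Space S] (τ : E → C(Square, Square))
    (hτ : ∀ x y, Glue D.next x y → Glue D.next (x.1, τ x.1 x.2) (y.1, τ y.1 y.2)) :
    ∃ ψ : C(S, S), ∀ e x, ψ (D.chart e x) = D.chart e (τ e x) := by
  let f : C(Σ _ : E, Square, S) :=
    ⟨fun p => D.chart p.1 (τ p.1 p.2), continuous_sigma fun e =>
      (D.continuous_chart e).comp (τ e).continuous⟩
  have hf : ∀ p q : Σ _ : E, Square, D.chart p.1 p.2 = D.chart q.1 q.2 → f p = f q := by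
    intro p q hpq
    exact (D.chart_eq_iff _ _ _ _).2
      (((Relation.EqvGen.is_equivalence (Glue D.next)).comap
        fun x : E × Square => (x.1, τ x.1 x.2)).eqvGen_iff.1
        (((D.chart_eq_iff _ _ _ _).1 hpq).mono fun x y h => .rel _ _ (hτ x y h)))
  let q : C(Σ _ : E, Square, S) := ⟨_, D.isQuotientMap_chart.continuous⟩
  have hq : Topology.IsQuotientMap q := D.isQuotientMap_chart
  exact ⟨hq.lift f hf, fun e x => ContinuousMap.congr_fun (hq.lift_comp f hf) ⟨e, x⟩⟩

theorem exists_homeomorph [Finite E] [T2Space S] (τ : E → Square ≃ₜ Square)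
    (hτ : ∀ x y, Glue D.next x y → Glue D.next (x.1, τ x.1 x.2) (y.1, τ y.1 y.2))
    (hτ_symm : ∀ x y, Glue D.next x y →
      Glue D.next (x.1, (τ x.1).symm x.2) (y.1, (τ y.1).symm y.2)) :
    ∃ ψ : S ≃ₜ S, ∀ e x, ψ (D.chart e x) = D.chart e (τ e x) := by
  obtain ⟨ψ, hψ⟩ := D.exists_continuousMap (fun e => (τ e : C(Square, Square))) hτ
  obtain ⟨χ, hχ⟩ := D.exists_continuousMap (fun e => ((τ e).symm : C(Square, Square))) hτ_symm
  refine ⟨⟨⟨ψ, χ, fun p => ?_, fun p => ?_⟩, ψ.continuous, χ.continuous⟩, hψ⟩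
  all_goals obtain ⟨e, x, rfl⟩ := D.chart_surjective p
  · simp [hψ, hχ]
  · simp [hψ, hχ]

end CellDecomposition

namespace ConicalMetric

variable {S : Type*} [TopologicalSpace S] {E F : Type*} {D : CellDecomposition S E F} {Φ : E → ℝ}

section LegAngle

variable (M : ConicalMetric D Φ)

theorem radius_mem_Ioc (f : F) : M.radius f ∈ Ioc 0 (π / 2) := ⟨M.radius_pos f, M.radius_le f⟩

theorem norm_coord (e : E) (x : Square) : ‖(M.coord e x : E3)‖ = 1 := (M.coord e x).2.1

theorem coord_ne_zero (e : E) (x : Square) : (M.coord e x : E3) ≠ 0 :=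
  norm_ne_zero_iff.1 ((M.norm_coord e x).trans_ne one_ne_zero)

/-- The spherical distance from a center of `Q(e)` to a point on one of the sides at it. -/
def legAngle (e : E) (s t : Bool) (c : unitInterval) : ℝ :=
  angle (M.coord e (leg s t 0) : E3) (M.coord e (leg s t c))

theorem legAngle_zero (e : E) (s t : Bool) : M.legAngle e s t 0 = 0 :=
  angle_self (M.coord_ne_zero e _)

theorem legAngle_le (e : E) (s t : Bool) (c : unitInterval) :
    M.legAngle e s t c ≤ M.legAngle e s t 1 :=
  (le_add_of_nonneg_right (angle_nonneg _ _)).trans_eq (M.coord_leg e s t c)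

theorem continuous_legAngle (e : E) (s t : Bool) : Continuous (M.legAngle e s t) := by
  have hcoord : Continuous fun c => (M.coord e (leg s t c) : E3) :=
    continuous_subtype_val.comp ((M.coord e).continuous.comp (continuous_leg s t))
  exact continuous_iff_continuousAt.2 fun c =>
    (continuousAt_angle (M.coord_ne_zero e _) (M.coord_ne_zero e _)).comp
      (f := fun c => ((M.coord e (leg s t 0) : E3), (M.coord e (leg s t c) : E3)))
      (continuousAt_const.prodMk hcoord.continuousAt)

theorem legAngle_one_ne_pi (hΦ : ∀ e, 0 < sin (Φ e)) (e : E) (s t : Bool) :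
    M.legAngle e s t 1 ≠ π := by
  have hsin := fun f => sin_pos_of_mem_Ioc (M.radius_mem_Ioc f)
  have hcos : 0 ≤ cos (M.legAngle e s t 1) := by
    rw [legAngle, cos_angle, M.norm_coord, M.norm_coord, mul_one, div_one, M.coord_center,
      M.coord_corner, inner_center_corner (hΦ e) (hsin _) (hsin _)]
    cases s <;> exact cos_nonneg_of_mem_Ioc (M.radius_mem_Ioc _)
  intro hpi
  rw [hpi, cos_pi] at hcos
  linarith

end LegAngle

variable {M M' : ConicalMetric D Φ} (hr : M.radius = M'.radius)
include hr

/-- The self-map of the model quadrilateral of `e` that two metrics with equal radii induce by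
identifying it in two ways with the same spherical quadrilateral. -/
def transition (e : E) : Square ≃ₜ Square :=
  (M.coord e).trans ((Homeomorph.setCongr (by rw [hr])).trans (M'.coord e).symm)

theorem coord_transition (e : E) (x : Square) :
    (M'.coord e (transition hr e x) : E3) = M.coord e x := by
  rw [transition, Homeomorph.trans_apply, Homeomorph.trans_apply, Homeomorph.apply_symm_apply]
  rfl

theorem legAngle_one_eq (e : E) (s t : Bool) : M.legAngle e s t 1 = M'.legAngle e s t 1 := by
  simp only [legAngle, coord_center, coord_corner, hr]

theorem exists_legAngle_eq (e : E) (s t : Bool) (c : unitInterval) :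
    ∃ c', M'.legAngle e s t c' = M.legAngle e s t c :=
  mem_range_of_exists_le_of_exists_ge (M'.continuous_legAngle e s t)
    ⟨0, (M'.legAngle_zero e s t).trans_le (angle_nonneg _ _)⟩
    ⟨1, (M.legAngle_le e s t c).trans_eq (legAngle_one_eq hr e s t)⟩

section Transition

variable (hΦ : ∀ e, 0 < sin (Φ e))
include hΦ

theorem transition_leg {e : E} {s t : Bool} {c c' : unitInterval}
    (h : M'.legAngle e s t c' = M.legAngle e s t c) :
    transition hr e (leg s t c) = leg s t c' := by
  have hcenter : (M.coord e (leg s t 0) : E3) = M'.coord e (leg s t 0) := by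
    rw [M.coord_center, M'.coord_center, hr]
  have hcorner : (M.coord e (leg s t 1) : E3) = M'.coord e (leg s t 1) := by
    rw [M.coord_corner, M'.coord_corner, hr]
  refine (M'.coord e).injective (Subtype.ext ((coord_transition hr e _).trans ?_))
  refine eq_of_angle_eq (M.norm_coord e _) (M'.norm_coord e _) (M.legAngle_one_ne_pi hΦ e s t)
    (M.coord_leg e s t c) ?_ (h.symm.trans ?_)
  · rw [hcenter, hcorner]
    exact M'.coord_leg e s t c'
  · rw [hcenter, legAngle]

theorem glue_transition {x y : E × Square} (h : Glue D.next x y) :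
    Glue D.next (x.1, transition hr x.1 x.2) (y.1, transition hr y.1 y.2) := by
  obtain ⟨⟨e, s, t⟩, c, rfl, rfl⟩ := h
  obtain ⟨c', hc'⟩ := exists_legAngle_eq hr e s t c
  rcases hnext : D.next (e, s, t) with ⟨e', s', t'⟩
  have hc'_next : M'.legAngle e' s' t' c' = M.legAngle e' s' t' c :=
    (M'.coord_glue e s t e' s' t' c' hnext).symm.trans
      (hc'.trans (M.coord_glue e s t e' s' t' c hnext))
  refine ⟨(e, s, t), c', ?_, ?_⟩
  · rw [transition_leg hr hΦ hc']
  · rw [transition_leg hr hΦ hc'_next, hnext]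

end Transition

section InducedMap

variable {ψ : S → S} (hψ : ∀ e x, ψ (D.chart e x) = D.chart e (transition hr e x))
include hψ

theorem localDist_map_le (p q : S) : M'.localDist (ψ p) (ψ q) ≤ M.localDist p q := by
  refine le_iInf fun e => le_iInf fun x => le_iInf fun y => le_iInf ?_
  rintro ⟨rfl, rfl⟩
  refine iInf_le_of_le e (iInf_le_of_le (transition hr e x) (iInf_le_of_le (transition hr e y)
    (iInf_le_of_le ⟨(hψ e x).symm, (hψ e y).symm⟩ ?_)))
  rw [coord_transition, coord_transition]

theorem dist_map_le (p q : S) : M'.dist (ψ p) (ψ q) ≤ M.dist p q := by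
  refine le_iInf fun n => le_iInf fun z => le_iInf ?_
  rintro ⟨rfl, rfl⟩
  exact iInf_le_of_le n (iInf_le_of_le (ψ ∘ z) (iInf_le_of_le ⟨rfl, rfl⟩
    (Finset.sum_le_sum fun i _ => localDist_map_le hr hψ _ _)))

theorem mapsTo_disk (f : F) : MapsTo ψ (M.disk f) (M'.disk f) := by
  rintro _ ⟨e, s, x, hf, rfl, hlt⟩
  refine ⟨e, s, transition hr e x, hf, (hψ e x).symm, ?_⟩
  rwa [coord_transition, ← hr]

theorem mapsTo_range_chart (e : E) : MapsTo ψ (range (D.chart e)) (range (D.chart e)) := by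
  rintro _ ⟨x, rfl⟩
  exact ⟨_, (hψ e x).symm⟩

end InducedMap

theorem isIsometric_of_radius_eq [Finite E] [T2Space S] (hΦ : ∀ e, 0 < sin (Φ e)) :
    M.IsIsometric M' := by
  obtain ⟨ψ, hψ⟩ := D.exists_homeomorph (transition hr) (fun _ _ => glue_transition hr hΦ)
    fun _ _ => glue_transition hr.symm hΦ
  have hψ_symm : ∀ e x, ψ.symm (D.chart e x) = D.chart e (transition hr.symm e x) := fun e x =>
    ψ.symm_apply_eq.2 ((congrArg _ ((transition hr e).apply_symm_apply x)).symm.trans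
      (hψ e _).symm)
  have image_eq : ∀ {A B : Set S}, MapsTo ψ A B → MapsTo ψ.symm B A → ψ '' A = B := fun hAB hBA =>
    hAB.image_subset.antisymm fun p hp => ⟨ψ.symm p, hBA hp, ψ.apply_symm_apply p⟩
  refine ⟨hr, ψ, fun p q => (dist_map_le hr hψ p q).antisymm ?_, fun f => ?_, fun e => ?_,
    fun e s t => ?_, fun e s t => ?_⟩
  · simpa only [ψ.symm_apply_apply] using dist_map_le hr.symm hψ_symm (ψ p) (ψ q)
  · exact image_eq (mapsTo_disk hr hψ f) (mapsTo_disk hr.symm hψ_symm f)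
  · exact image_eq (mapsTo_range_chart hr hψ e) (mapsTo_range_chart hr.symm hψ_symm e)
  · rw [hψ, transition_leg hr hΦ (c' := 0) (by rw [legAngle_zero, legAngle_zero])]
  · rw [hψ, transition_leg hr hΦ (legAngle_one_eq hr e s t).symm]

end ConicalMetric

/-! ### Existence, and the set of total curvatures -/

namespace ConicalMetric

variable {S : Type*} [TopologicalSpace S] {E F : Type*} {D : CellDecomposition S E F} {Φ : E → ℝ}

/-- The conical metric with prescribed radii. -/
def ofRadius (D : CellDecomposition S E F) (hΦ : ∀ e, Φ e ∈ Ioc 0 (π / 2)) (r : F → ℝ)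
    (hr : ∀ f, r f ∈ Ioc 0 (π / 2)) : ConicalMetric D Φ where
  radius := r
  radius_pos f := (hr f).1
  radius_le f := (hr f).2
  coord e := quadHomeomorph (hΦ e) (hr (D.face e false)) (hr (D.face e true))
  coord_center e := quadHomeomorph_leg_zero (hΦ e) (hr _) (hr _)
  coord_corner e := quadHomeomorph_leg_one (hΦ e) (hr _) (hr _)
  coord_leg e := angle_quadHomeomorph_leg (hΦ e) (hr _) (hr _)
  coord_glue e s t e' s' t' c hnext := by
    have hside : ∀ e s, cond s (r (D.face e true)) (r (D.face e false)) = r (D.face e s) := by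
      rintro e (_ | _) <;> rfl
    exact angle_quadHomeomorph_leg_congr (hΦ e) (hr _) (hr _) (hΦ e') (hr _) (hr _)
      (by rw [hside, hside, D.face_eq_of_next hnext]) t t' c

section GeodesicCurvature

variable (M : ConicalMetric D Φ)

/-- Geodesic curvatures of the circles of the pattern. -/
def geodesicCurvature (f : F) : ℝ := cot (M.radius f)

theorem geodesicCurvature_nonneg : 0 ≤ M.geodesicCurvature := fun f => by
  rw [geodesicCurvature, cot_eq_cos_div_sin]
  exact div_nonneg (cos_nonneg_of_mem_Ioc (M.radius_mem_Ioc f))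
    (sin_pos_of_mem_Ioc (M.radius_mem_Ioc f)).le

theorem radius_mem_Ioo (f : F) : M.radius f ∈ Ioo 0 π :=
  ⟨M.radius_pos f, (M.radius_le f).trans_lt (half_lt_self pi_pos)⟩

theorem arccot_geodesicCurvature (f : F) : arccot (M.geodesicCurvature f) = M.radius f :=
  arccot_cot (M.radius_mem_Ioo f).1 (M.radius_mem_Ioo f).2

theorem geodesicCurvature_eq_zero_iff (f : F) :
    M.geodesicCurvature f = 0 ↔ M.radius f = π / 2 := by
  rw [← M.arccot_geodesicCurvature, arccot, sub_eq_self, arctan_eq_zero_iff]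

theorem totalCurvature_eq_curvatureMap [Fintype E] (hΦ : ∀ e, 0 < sin (Φ e)) :
    M.totalCurvature = curvatureMap D.face Φ M.geodesicCurvature := by
  have hsin := fun f => sin_pos_of_mem_Ioc (M.radius_mem_Ioc f)
  funext f
  refine Finset.sum_congr rfl fun e _ => Finset.sum_congr rfl fun s _ => ?_
  rw [sideCurvature_eq_sideTotal (hΦ e) (hsin _) (hsin _) (M.radius_mem_Ioo _)]
  rfl

theorem isDegenerated_iff [Fintype E] (hΦ : ∀ e, 0 < sin (Φ e)) :
    M.IsDegenerated ↔ ∃ f, M.totalCurvature f = 0 := by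
  refine exists_congr fun f => ?_
  rw [M.totalCurvature_eq_curvatureMap hΦ,
    curvatureMap_eq_zero_iff D.face_surjective M.geodesicCurvature_nonneg,
    M.geodesicCurvature_eq_zero_iff]

end GeodesicCurvature

theorem exists_geodesicCurvature_eq (D : CellDecomposition S E F) (hΦ : ∀ e, Φ e ∈ Ioc 0 (π / 2))
    {k : F → ℝ} (hk : 0 ≤ k) : ∃ M : ConicalMetric D Φ, M.geodesicCurvature = k :=
  ⟨ofRadius D hΦ (fun f => arccot (k f)) fun f =>
    ⟨arccot_pos _, sub_le_self _ (arctan_nonneg.2 (hk f))⟩, funext fun f => cot_arccot (k f)⟩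

variable [Fintype E] [Finite F]

theorem exists_totalCurvature_eq_iff (hΦ : ∀ e, Φ e ∈ Ioc 0 (π / 2)) {L : F → ℝ} :
    (∃ M : ConicalMetric D Φ, M.totalCurvature = L) ↔ L ∈ admissibleCurvatures D.face Φ := by
  have hsin := fun e => sin_pos_of_mem_Ioc (hΦ e)
  have hbij := bijOn_curvatureMap (fun e => ⟨(hΦ e).1, (hΦ e).2.trans_lt (half_lt_self pi_pos)⟩)
    D.face_surjective
  constructor
  · rintro ⟨M, rfl⟩
    rw [M.totalCurvature_eq_curvatureMap hsin]
    exact hbij.mapsTo M.geodesicCurvature_nonneg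
  · intro hL
    obtain ⟨k, hk, rfl⟩ := hbij.surjOn hL
    obtain ⟨M, rfl⟩ := exists_geodesicCurvature_eq D hΦ hk
    exact ⟨M, M.totalCurvature_eq_curvatureMap hsin⟩

theorem radius_eq_of_totalCurvature_eq (hΦ : ∀ e, Φ e ∈ Ioo 0 π) {M M' : ConicalMetric D Φ}
    (h : M.totalCurvature = M'.totalCurvature) : M.radius = M'.radius := by
  have hsin := fun e => sin_pos_of_mem_Ioo (hΦ e)
  rw [M.totalCurvature_eq_curvatureMap hsin, M'.totalCurvature_eq_curvatureMap hsin] at h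
  have hk := (bijOn_curvatureMap hΦ D.face_surjective).injOn M.geodesicCurvature_nonneg
    M'.geodesicCurvature_nonneg h
  funext f
  rw [← M.arccot_geodesicCurvature, hk, M'.arccot_geodesicCurvature]

end ConicalMetric

section DegeneratedCurvatureSet

variable {S : Type*} [TopologicalSpace S] {E F : Type*} [Fintype E] {D : CellDecomposition S E F}
  {Φ : E → ℝ} {L : F → ℝ} (hΦ : ∀ e, 0 < Φ e)
include hΦ

theorem sum_edgesOf_pos {F' : Finset F} (hF' : F'.Nonempty) : 0 < ∑ e ∈ edgesOf D F', Φ e := by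
  classical
  obtain ⟨f, hf⟩ := hF'
  obtain ⟨e, s, rfl⟩ := D.face_surjective f
  exact Finset.sum_pos (fun e _ => hΦ e) ⟨e, Finset.mem_filter.2 ⟨Finset.mem_univ e, s, hf⟩⟩

theorem mem_curvatureSet_iff {I : Finset F} :
    L ∈ curvatureSet D Φ I ↔
      L ∈ admissibleCurvatures D.face Φ ∧ (∀ f ∉ I, L f = 0) ∧ ∀ f ∈ I, 0 < L f := by
  classical
  refine ⟨fun ⟨hzero, hpos, hlt⟩ => ⟨⟨fun f => ?_, fun F' hF' => ?_⟩, hzero, hpos⟩,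
    fun ⟨hL, hzero, hpos⟩ => ⟨hzero, hpos, fun F' _ => hL.2 F'⟩⟩
  · by_cases hf : f ∈ I
    exacts [(hpos f hf).le, (hzero f hf).ge]
  · have hsum : ∑ f ∈ F' ∩ I, L f = ∑ f ∈ F', L f :=
      Finset.sum_subset Finset.inter_subset_left fun f hf hfI =>
        hzero f fun hI => hfI (Finset.mem_inter.2 ⟨hf, hI⟩)
    rw [← hsum]
    rcases (F' ∩ I).eq_empty_or_nonempty with hempty | hne
    · rw [hempty, Finset.sum_empty]
      exact mul_pos two_pos (sum_edgesOf_pos hΦ hF')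
    · have hsub : edgesOf D (F' ∩ I) ⊆ incidentEdges D.face F' :=
        Finset.monotone_filter_right _ fun e _ ⟨s, hs⟩ => ⟨s, Finset.mem_of_mem_inter_left hs⟩
      refine (hlt _ Finset.inter_subset_right hne).trans_le ?_
      gcongr
      exact fun e _ _ => (hΦ e).le

theorem mem_degeneratedCurvatureSet_iff [Fintype F] [Nonempty F] :
    L ∈ degeneratedCurvatureSet D Φ ↔
      L ∈ admissibleCurvatures D.face Φ ∧ ∃ f, L f = 0 := by
  classical
  constructor
  · rintro (hL | rfl)
    · obtain ⟨I, ⟨-, hI⟩, hLI⟩ := mem_iUnion₂.1 hL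
      obtain ⟨hadm, hzero, -⟩ := (mem_curvatureSet_iff hΦ).1 hLI
      obtain ⟨f, hf⟩ := not_forall.1 (mt Finset.eq_univ_iff_forall.2 hI)
      exact ⟨hadm, f, hzero f hf⟩
    · exact ⟨((mem_curvatureSet_iff hΦ (I := ∅)).1 (by simp [curvatureSet])).1,
        Classical.arbitrary F, rfl⟩
  · rintro ⟨hadm, f, hf⟩
    let I : Finset F := Finset.univ.filter fun f => 0 < L f
    have hzero : ∀ f ∉ I, L f = 0 := fun f hf =>
      ((hadm.1 f).eq_of_not_lt fun hlt => hf (Finset.mem_filter.2 ⟨Finset.mem_univ f, hlt⟩)).symm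
    rcases I.eq_empty_or_nonempty with hempty | hne
    · exact .inr (funext fun f => hzero f (hempty ▸ Finset.notMem_empty f))
    · have hfI : f ∉ I := fun hmem => (Finset.mem_filter.1 hmem).2.ne' hf
      exact .inl (mem_iUnion₂.2 ⟨I, ⟨hne, fun huniv => hfI (huniv ▸ Finset.mem_univ f)⟩,
        (mem_curvatureSet_iff hΦ).2 ⟨hadm, hzero, fun f hf => (Finset.mem_filter.1 hf).2⟩⟩)

end DegeneratedCurvatureSet

end SphericalPattern

end

open SphericalPattern in
theorem theorem1p5_general {S : Type*} [TopologicalSpace S] [T2Space S] [Nonempty S]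
    {E F : Type*} [Fintype E] [Fintype F] (D : CellDecomposition S E F)
    (Φ : E → ℝ) (hΦ : ∀ e, 0 < Φ e ∧ Φ e ≤ Real.pi / 2) (L : F → ℝ) :
    ((∃ M : ConicalMetric D Φ, M.IsDegenerated ∧ M.totalCurvature = L) ↔
      L ∈ degeneratedCurvatureSet D Φ) ∧
    ∀ M M' : ConicalMetric D Φ, M.totalCurvature = M'.totalCurvature → M.IsIsometric M' := by
  have hsin : ∀ e, 0 < Real.sin (Φ e) := fun e => sin_pos_of_mem_Ioc (hΦ e)
  have hΦ_lt_pi : ∀ e, Φ e ∈ Set.Ioo 0 Real.pi := fun e =>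
    ⟨(hΦ e).1, (hΦ e).2.trans_lt (half_lt_self Real.pi_pos)⟩
  have : Nonempty F := by
    obtain ⟨e, -⟩ := D.chart_surjective (Classical.arbitrary S)
    exact ⟨D.face e true⟩
  refine ⟨?_, fun M M' h => ConicalMetric.isIsometric_of_radius_eq
    (ConicalMetric.radius_eq_of_totalCurvature_eq hΦ_lt_pi h) hsin⟩
  rw [mem_degeneratedCurvatureSet_iff fun e => (hΦ e).1,
    ← ConicalMetric.exists_totalCurvature_eq_iff hΦ]
  constructor
  · rintro ⟨M, hM, rfl⟩
    exact ⟨⟨M, rfl⟩, (M.isDegenerated_iff hsin).1 hM⟩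
  · rintro ⟨⟨M, rfl⟩, hzero⟩
    exact ⟨M, (M.isDegenerated_iff hsin).2 hzero, rfl⟩

theorem theorem1p5 {S : Type*} [TopologicalSpace S] [CompactSpace S] [T2Space S] [Nonempty S]
    [ChartedSpace (EuclideanSpace ℝ (Fin 2)) S] {E F : Type*} [Fintype E] [Fintype F]
    (D : SphericalPattern.CellDecomposition S E F)
    (Φ : E → ℝ) (hΦ : ∀ e, 0 < Φ e ∧ Φ e < Real.pi / 2) (L : F → ℝ) :
    ((∃ M : SphericalPattern.ConicalMetric D Φ, M.IsDegenerated ∧ M.totalCurvature = L) ↔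
      L ∈ SphericalPattern.degeneratedCurvatureSet D Φ) ∧
    ∀ M M' : SphericalPattern.ConicalMetric D Φ,
      M.IsDegenerated → M.totalCurvature = L → M'.IsDegenerated → M'.totalCurvature = L →
      M.IsIsometric M' :=
  (theorem1p5_general D Φ (fun e => (hΦ e).imp_right le_of_lt) L).imp_right
    fun huniq M M' _ hM _ hM' => huniq M M' (hM.trans hM'.symm)
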